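/- Let $d\ge 2$, let $\xi^+\neq\xi^-$ be points of the unit sphere $\mathbb S^{d-1}\subset\mathbb R^d$, let $V_{\min}>0$ and $\alpha\in(0,2)$. Let $V\in\mathcal C^2(\mathbb S^{d-1})$ satisfy $V(s)\ge V(\xi^\pm)=V_{\min}$ for every $s\in\mathbb S^{d-1}$, and suppose that there are $\delta,\mu>0$ such that $V(s)-V(\xi^\pm)\ge\mu|s-\xi^\pm|^2$ whenever $|s-\xi^\pm|<\delta$. Extend $V$ to $\mathbb R^d\setminus\{0\}$ by $V(x)=V(x/|x|)/|x|^\alpha$, and put $V(0)=+\infty$. For $a<b$ and $x\in H^1((a,b);\mathbb R^d)$ (identified with its continuous representative on $[a,b]$) let \[ \mathcal A([a,b];x)=\int_a^b\Big(\tfrac12|\dot x(t)|^2+V(x(t))\Big)\,dt\in[0,+\infty], \] and let \[ c(V)=\inf\{\mathcal A([a,b];x): a<b,\ x\in H^1((a,b);\mathbb R^d),\ x(a)=\xi^-,\ x(b)=\xi^+\}. \] Then this infimum is attained, and exactly one of the following two alternatives holds. (1) $c(V)=4\sqrt{2V_{\min}}/(2-\alpha)$, and it is attained by a juxtaposition of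 two homothetic motions, the first from $\xi^-$ to the origin and the second from the origin to $\xi^+$; that is, by a path $x$ on some $[a,b]$ for which there is $\tau\in(a,b)$ with $x(\tau)=0$, $x(t)=|x(t)|\,\xi^-$ on $[a,\tau]$, $x(t)=|x(t)|\,\xi^+$ on $[\tau,b]$, and such that $x\ne0$ and $\ddot x=\nabla V(x)$ on $(a,\tau)\cup(\tau,b)$. (2) $c(V)<4\sqrt{2V_{\min}}/(2-\alpha)$, and there is $\rho>0$ such that every minimizer, that is, every admissible $x$ on an interval $[a,b]$ with $\mathcal A([a,b];x)=c(V)$, satisfies $|x(t)|\ge\rho$ for all $t\in[a,b]$ and is a classical solution of $\ddot x=\nabla V(x)$ on $(a,b)$. -/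

import Mathlib

open scoped Manifold ContDiff ENNReal

noncomputable section

namespace AnisotropicKepler

/-- The ambient space `ℝ^d` with `d = n + 1`, with its Euclidean norm. -/
abbrev Space (n : ℕ) : Type := EuclideanSpace ℝ (Fin (n + 1))

/-- The unit sphere `S^{d-1} = S^n` of `ℝ^d`. -/
abbrev UnitSphere (n : ℕ) : Type := Metric.sphere (0 : Space n) 1

/-- The radial projection `x ↦ x / |x|` of `ℝ^d \ {0}` onto the unit sphere. -/
def direction {n : ℕ} (x : Space n) (hx : x ≠ 0) : UnitSphere n :=
  ⟨‖x‖⁻¹ • x, by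
    rw [mem_sphere_zero_iff_norm, norm_smul, norm_inv, norm_norm]
    exact inv_mul_cancel₀ (norm_ne_zero_iff.mpr hx)⟩

/-- The class `𝒮`: functions of class `C²` on the sphere, with global minimum value `Vmin` attained
at both `ξm` (that is, `ξ⁻`) and `ξp` (that is, `ξ⁺`), both minima being non-degenerate. -/
structure ClassS {n : ℕ} (ξm ξp : UnitSphere n) (Vmin : ℝ) (U : UnitSphere n → ℝ) : Prop where
  contMDiff : ContMDiff (𝓡 n) 𝓘(ℝ, ℝ) 2 U
  eq_left : U ξm = Vmin
  eq_right : U ξp = Vmin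
  min_le : ∀ s, Vmin ≤ U s
  nondegenerate : ∃ δ > 0, ∃ μ > 0, ∀ s : UnitSphere n,
    (‖(s : Space n) - ξm‖ < δ → μ * ‖(s : Space n) - ξm‖ ^ 2 ≤ U s - U ξm) ∧
    (‖(s : Space n) - ξp‖ < δ → μ * ‖(s : Space n) - ξp‖ ^ 2 ≤ U s - U ξp)

/-- The class `𝒫` of pairs `(U, α)` with `U ∈ 𝒮` and `α ∈ (0, 2)`. -/
def classP {n : ℕ} (ξm ξp : UnitSphere n) (Vmin : ℝ) : Set ((UnitSphere n → ℝ) × ℝ) :=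
  {p | ClassS ξm ξp Vmin p.1 ∧ p.2 ∈ Set.Ioo (0 : ℝ) 2}

open Classical in
/-- The `-α`-homogeneous extension `V(x) = U(x / |x|) / |x|^α`, for `x ≠ 0`.
The value at the origin is a placeholder; see `singularPotential`. -/
def potential {n : ℕ} (p : (UnitSphere n → ℝ) × ℝ) (x : Space n) : ℝ :=
  if hx : x = 0 then 0 else p.1 (direction x hx) / ‖x‖ ^ p.2

open Classical in
/-- The potential as a function on all of `ℝ^d`, with the value `+∞` at the singularity. -/
def singularPotential {n : ℕ} (p : (UnitSphere n → ℝ) × ℝ) (x : Space n) : ℝ≥0∞ :=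
  if x = 0 then ⊤ else ENNReal.ofReal (potential p x)

/-- `x ∈ H¹((a, b); ℝ^d)`, for the continuous representative on `[a, b]`: `x` is absolutely
continuous on `[a, b]` and its (almost everywhere defined) derivative is square integrable. -/
def IsH1 {n : ℕ} (a b : ℝ) (x : ℝ → Space n) : Prop :=
  AbsolutelyContinuousOnInterval x a b ∧
    MeasureTheory.MemLp (deriv x) 2 (MeasureTheory.volume.restrict (Set.Ioo a b))

/-- The (possibly infinite) action `∫_a^b (|ẋ|² / 2 + V(x)) dt`. -/
def action {n : ℕ} (p : (UnitSphere n → ℝ) × ℝ) (a b : ℝ) (x : ℝ → Space n) : ℝ≥0∞ :=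
  ∫⁻ t in Set.Ioo a b,
    (ENNReal.ofReal (1 / 2 * ‖deriv x t‖ ^ 2) + singularPotential p (x t))

/-- `x` is an `H¹` path on `[a, b]`, `a < b`, that joins `ξm` to `ξp`. -/
structure IsAdmissible {n : ℕ} (ξm ξp : UnitSphere n) (a b : ℝ) (x : ℝ → Space n) : Prop where
  lt : a < b
  isH1 : IsH1 a b x
  left : x a = ξm
  right : x b = ξp

/-- The fixed-endpoints level `c(V)`: the infimum of the action over all time intervals and all
`H¹` paths joining `ξm` to `ξp`. -/
def level {n : ℕ} (ξm ξp : UnitSphere n) (p : (UnitSphere n → ℝ) × ℝ) : ℝ≥0∞ :=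
  sInf {A | ∃ (a b : ℝ) (x : ℝ → Space n), IsAdmissible ξm ξp a b x ∧ A = action p a b x}

/-- The path `x` on `[a, b]` achieves `c(V)`. -/
def Achieves {n : ℕ} (ξm ξp : UnitSphere n) (p : (UnitSphere n → ℝ) × ℝ)
    (a b : ℝ) (x : ℝ → Space n) : Prop :=
  IsAdmissible ξm ξp a b x ∧ action p a b x = level ξm ξp p

/-- `x` is a collisionless classical solution of `ẍ = ∇V(x)` on the open interval `(a, b)`. -/
def IsSolution {n : ℕ} (p : (UnitSphere n → ℝ) × ℝ) (a b : ℝ) (x : ℝ → Space n) : Prop :=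
  ∀ t ∈ Set.Ioo a b, x t ≠ 0 ∧ DifferentiableAt ℝ x t ∧
    HasDerivAt (deriv x) (gradient (potential p) (x t)) t

/-- `x` is, on `[a, b]`, a homothetic motion in the direction `ξ`: a solution of `ẍ = ∇V(x)` in
`(a, b)` whose angular part is constantly equal to `ξ`. -/
def IsHomothetic {n : ℕ} (p : (UnitSphere n → ℝ) × ℝ) (ξ : UnitSphere n)
    (a b : ℝ) (x : ℝ → Space n) : Prop :=
  IsSolution p a b x ∧ ∀ t ∈ Set.Icc a b, x t = ‖x t‖ • (ξ : Space n)

/-- `x` is, on `[a, b]`, the juxtaposition of a homothetic motion from `ξm` to the origin and of a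
homothetic motion from the origin to `ξp`. -/
def IsDoubleHomothetic {n : ℕ} (ξm ξp : UnitSphere n) (p : (UnitSphere n → ℝ) × ℝ)
    (a b : ℝ) (x : ℝ → Space n) : Prop :=
  x a = ξm ∧ x b = ξp ∧ ∃ τ ∈ Set.Ioo a b, x τ = 0 ∧
    IsHomothetic p ξm a τ x ∧ IsHomothetic p ξp τ b x

end AnisotropicKepler

end

open MeasureTheory Set Filter Topology

/-! ### Absolutely continuous functions with values in a normed space -/

section AbsolutelyContinuous

variable {E : Type*} [NormedAddCommGroup E] [NormedSpace ℝ E] {a b : ℝ}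

/-! Everything rests on one radial estimate. Let `Φ(r) = 2√(2Vmin)/(2-α) · r^(1-α/2)`, the primitive
of `√(2Vmin) r^(-α/2)` vanishing at `0` (`radialCost`). Since `V(x) ≥ Vmin/|x|^α`, Young's
inequality gives `|ẋ|²/2 + V(x) ≥ √(2Vmin) |x|^(-α/2) |ẋ| ≥ |d/dt Φ(|x|)|`. An admissible path
starts and ends on the unit sphere, so reaching radius `r` costs at least `2|Φ(r) - Φ(1)|`; in
particular a collision costs at least `2Φ(1) = 4√(2Vmin)/(2-α)`, the threshold.

The two zero-energy homothetic motions glued at the origin turn these inequalities into equalities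
(`action_collisionPath`), so the level never exceeds the threshold. If the two are equal, this path
is a minimizer and the first alternative holds.

If the level is strictly smaller, paths with action at most a fixed value below the threshold stay
in a fixed annulus `ρ ≤ |x| ≤ R` (`exists_annulus`). The bound `R` controls the durations and `ρ`
keeps limits away from the singularity, so the direct method gives a minimizer
(`exists_achieves_of_level_lt`). All minimizers lie in one such annulus, where the potential is
smooth, so the first variation and the du Bois-Reymond argument give the equation of motion
(`Achieves.isSolution`). The alternatives exclude each other because one has equality where the
other has strict inequality. -/

theorem AbsolutelyContinuousOnInterval.of_dist_le {X Y : Type*} [PseudoMetricSpace X]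
    [PseudoMetricSpace Y] {f : ℝ → X} {g : ℝ → Y} (hg : AbsolutelyContinuousOnInterval g a b)
    (h : ∀ s ∈ uIcc a b, ∀ t ∈ uIcc a b, dist (f s) (f t) ≤ dist (g s) (g t)) :
    AbsolutelyContinuousOnInterval f a b := by
  rw [absolutelyContinuousOnInterval_iff] at hg ⊢
  intro ε hε
  obtain ⟨δ, hδ, H⟩ := hg ε hε
  refine ⟨δ, hδ, fun I hI hIδ => lt_of_le_of_lt (Finset.sum_le_sum fun i hi => ?_) (H I hI hIδ)⟩
  exact h _ (hI.1 i hi).1 _ (hI.1 i hi).2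

theorem LipschitzWith.comp_absolutelyContinuousOnInterval {X Y : Type*} [PseudoMetricSpace X]
    [PseudoMetricSpace Y] {K : NNReal} {F : X → Y} (hF : LipschitzWith K F) {f : ℝ → X}
    (hf : AbsolutelyContinuousOnInterval f a b) :
    AbsolutelyContinuousOnInterval (fun t => F (f t)) a b := by
  rw [absolutelyContinuousOnInterval_iff] at hf ⊢
  intro ε hε
  obtain ⟨δ, hδ, H⟩ := hf (ε / (K + 1)) (by positivity)
  refine ⟨δ, hδ, fun I hI hIδ => ?_⟩
  have h1 := H I hI hIδ
  calc _ ≤ ∑ i ∈ Finset.range I.1, (K + 1 : ℝ) * dist (f (I.2 i).1) (f (I.2 i).2) := by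
        refine Finset.sum_le_sum fun i _ => (hF.dist_le_mul _ _).trans ?_
        gcongr
        linarith
    _ < ε := by
        rw [← Finset.mul_sum]
        calc _ < (K + 1 : ℝ) * (ε / (K + 1)) := by gcongr
          _ = ε := by field_simp

theorem IntervalIntegrable.absolutelyContinuousOnInterval_integral_normed {v : ℝ → E}
    (hv : IntervalIntegrable v volume a b) :
    AbsolutelyContinuousOnInterval (fun t => ∫ s in a..t, v s) a b := by
  refine (hv.norm.absolutelyContinuousOnInterval_intervalIntegral left_mem_uIcc).of_dist_le
    fun s hs t ht => ?_
  have hI : ∀ {r}, r ∈ uIcc a b → IntervalIntegrable v volume a r := fun hr =>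
    hv.mono_set (uIcc_subset_uIcc left_mem_uIcc hr)
  rw [dist_eq_norm, Real.dist_eq, intervalIntegral.integral_interval_sub_left (hI hs) (hI ht),
    intervalIntegral.integral_interval_sub_left (hI hs).norm (hI ht).norm]
  exact intervalIntegral.norm_integral_le_abs_integral_norm

/-- Subtracting from `f` the primitive of its derivative leaves an absolutely continuous function
with zero derivative almost everywhere, hence a constant. Finite dimension provides the almost
everywhere differentiability of `f`. -/
theorem AbsolutelyContinuousOnInterval.integral_deriv_eq_sub_normed [FiniteDimensional ℝ E]
    {f : ℝ → E} (hf : AbsolutelyContinuousOnInterval f a b)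
    (hf' : IntervalIntegrable (deriv f) volume a b) :
    ∫ t in a..b, deriv f t = f b - f a := by
  have hg : AbsolutelyContinuousOnInterval (fun t => f t - ∫ s in a..t, deriv f s) a b :=
    hf.fun_sub hf'.absolutelyContinuousOnInterval_integral_normed
  obtain ⟨C, hC⟩ := hg.const_of_ae_hasDerivAt_zero (by
    filter_upwards [hf.boundedVariationOn.ae_differentiableAt_of_mem_uIcc,
      hf'.ae_hasDerivAt_integral] with t h1 h2 ht
    have := (h1 ht).hasDerivAt.sub (h2 ht a left_mem_uIcc)
    rwa [sub_self] at this)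
  have h1 := hC a left_mem_uIcc
  have h2 := hC b right_mem_uIcc
  simp only [intervalIntegral.integral_same, sub_zero] at h1
  rw [← h1] at h2
  rw [← h2]; abel

end AbsolutelyContinuous

namespace AnisotropicKepler

variable {n : ℕ} {a b : ℝ} {x : ℝ → Space n}

/-! ### Sobolev paths -/

theorem intervalIntegrable_of_memLp_Ioo {E : Type*} [NormedAddCommGroup E] {v : ℝ → E}
    (hv : MemLp v 2 (volume.restrict (Ioo a b))) (hab : a ≤ b) :
    IntervalIntegrable v volume a b := by
  rw [intervalIntegrable_iff_integrableOn_Ioo_of_le hab]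
  exact hv.integrable one_le_two

theorem IsH1.intervalIntegrable_deriv (hx : IsH1 a b x) (hab : a ≤ b) :
    IntervalIntegrable (deriv x) volume a b :=
  intervalIntegrable_of_memLp_Ioo hx.2 hab

theorem IsH1.continuousOn (hx : IsH1 a b x) (hab : a ≤ b) : ContinuousOn x (Icc a b) := by
  simpa [uIcc_of_le hab] using hx.1.continuousOn

theorem IsH1.ae_differentiableAt (hx : IsH1 a b x) (hab : a ≤ b) :
    ∀ᵐ t ∂volume.restrict (Ioo a b), DifferentiableAt ℝ x t := by
  rw [ae_restrict_iff' measurableSet_Ioo]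
  filter_upwards [hx.1.boundedVariationOn.ae_differentiableAt_of_mem_uIcc] with t ht hmem
  exact ht (by rw [uIcc_of_le hab]; exact Ioo_subset_Icc_self hmem)

theorem IsH1.mono (hx : IsH1 a b x) {s t : ℝ} (has : a ≤ s) (hst : s ≤ t) (htb : t ≤ b) :
    IsH1 s t x := by
  refine ⟨hx.1.mono ?_, hx.2.mono_measure (Measure.restrict_mono (Ioo_subset_Ioo has htb) le_rfl)⟩
  rw [uIcc_of_le hst, uIcc_of_le (has.trans (hst.trans htb))]
  exact Icc_subset_Icc has htb

theorem IsH1.integral_deriv (hx : IsH1 a b x) {t : ℝ} (ht : t ∈ Icc a b) :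
    x t = x a + ∫ s in a..t, deriv x s := by
  have h := hx.mono le_rfl ht.1 ht.2
  rw [h.1.integral_deriv_eq_sub_normed (h.intervalIntegrable_deriv ht.1)]
  abel

theorem ae_deriv_of_eq_integral {v : ℝ → Space n} (hab : a ≤ b)
    (hv : MemLp v 2 (volume.restrict (Ioo a b)))
    (hx : ∀ t ∈ Icc a b, x t = x a + ∫ s in a..t, v s) :
    ∀ᵐ t ∂volume.restrict (Ioo a b), HasDerivAt x (v t) t := by
  have hI := intervalIntegrable_of_memLp_Ioo hv hab
  rw [ae_restrict_iff' measurableSet_Ioo]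
  filter_upwards [hI.ae_hasDerivAt_integral] with t ht hmem
  have h1 := (ht (by rw [uIcc_of_le hab]; exact Ioo_subset_Icc_self hmem) a
    left_mem_uIcc).const_add (x a)
  refine h1.congr_of_eventuallyEq ?_
  filter_upwards [isOpen_Ioo.mem_nhds hmem] with s hs
  exact hx s (Ioo_subset_Icc_self hs)

/-- Every path constructed below (the collision path, the weak limit, the variations of a minimizer)
is given as a primitive of a square integrable velocity and enters `H¹` through this criterion. -/
theorem isH1_of_eq_integral {v : ℝ → Space n} (hab : a ≤ b)
    (hv : MemLp v 2 (volume.restrict (Ioo a b)))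
    (hx : ∀ t ∈ Icc a b, x t = x a + ∫ s in a..t, v s) : IsH1 a b x := by
  have hI := intervalIntegrable_of_memLp_Ioo hv hab
  refine ⟨hI.absolutelyContinuousOnInterval_integral_normed.of_dist_le fun s hs t ht => ?_, ?_⟩
  · rw [uIcc_of_le hab] at hs ht
    rw [hx s hs, hx t ht, dist_add_left]
  · refine (memLp_congr_ae ?_).2 hv
    filter_upwards [ae_deriv_of_eq_integral hab hv hx] with t ht
    exact ht.deriv

end AnisotropicKepler

namespace AnisotropicKepler

variable {n : ℕ} {ξm ξp : UnitSphere n} {Vmin : ℝ} {p : (UnitSphere n → ℝ) × ℝ}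

/-! ### The potential away from the origin -/

theorem potential_of_ne {x : Space n} (hx : x ≠ 0) :
    potential p x = p.1 (direction x hx) / ‖x‖ ^ p.2 := by
  rw [potential, dif_neg hx]

/-- Smoothness of the angular factor is a statement on the sphere as a manifold. It is pulled back
by the radial projection on the open submanifold `ℝ^d \ {0}`, and the result is then read as
ordinary differentiability. -/
theorem contDiffAt_potential (hp : ContMDiff (𝓡 n) 𝓘(ℝ, ℝ) 2 p.1) {x : Space n} (hx : x ≠ 0) :
    ContDiffAt ℝ 2 (potential p) x := by
  let O : TopologicalSpace.Opens (Space n) := ⟨{0}ᶜ, isOpen_compl_singleton⟩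
  have hne : ∀ y : O, (y : Space n) ≠ 0 := fun y => y.2
  have hval : ContMDiff 𝓘(ℝ, Space n) 𝓘(ℝ, Space n) 2 (fun y : O => (y : Space n)) :=
    contMDiff_subtype_val
  have hdir0 : ContMDiff 𝓘(ℝ, Space n) 𝓘(ℝ, Space n) 2
      (fun y : O => ‖(y : Space n)‖⁻¹ • (y : Space n)) := fun y =>
    ContMDiffAt.comp (f := fun z : O => (z : Space n)) (g := fun z : Space n => ‖z‖⁻¹ • z) y
      (((contDiffAt_norm ℝ (hne y)).inv (norm_ne_zero_iff.2 (hne y))).smul contDiffAt_id).contMDiffAt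
      (hval y)
  have hfact : Fact (Module.finrank ℝ (Space n) = n + 1) := ⟨finrank_euclideanSpace_fin⟩
  have hdir : ContMDiff 𝓘(ℝ, Space n) (𝓡 n) 2 (fun y : O => direction (y : Space n) (hne y)) :=
    hdir0.codRestrict_sphere fun y => (direction (y : Space n) (hne y)).2
  have hU := hp.comp hdir
  have hpow : ContDiffAt ℝ 2 (fun z : Space n => (‖z‖ ^ p.2)⁻¹) x :=
    ((contDiffAt_norm ℝ hx).rpow_const_of_ne (norm_ne_zero_iff.2 hx)).inv
      (Real.rpow_pos_of_pos (norm_pos_iff.2 hx) _).ne'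
  have hpow' : ContMDiffAt 𝓘(ℝ, Space n) 𝓘(ℝ, ℝ) 2
      (fun y : O => (‖(y : Space n)‖ ^ p.2)⁻¹) (⟨x, hx⟩ : O) :=
    ContMDiffAt.comp (f := fun z : O => (z : Space n)) (g := fun z : Space n => (‖z‖ ^ p.2)⁻¹)
      (⟨x, hx⟩ : O) hpow.contMDiffAt (hval _)
  have hprod := (hU (⟨x, hx⟩ : O)).mul hpow'
  have h : ContMDiffAt 𝓘(ℝ, Space n) 𝓘(ℝ, ℝ) 2
      (fun y : O => potential p (y : Space n)) (⟨x, hx⟩ : O) := by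
    convert hprod using 1
    funext y
    simp [potential_of_ne (hne y), div_eq_mul_inv]
  exact (contMDiffAt_subtype_iff.1 h).contDiffAt

theorem differentiableAt_potential (hp : ContMDiff (𝓡 n) 𝓘(ℝ, ℝ) 2 p.1) {x : Space n}
    (hx : x ≠ 0) : DifferentiableAt ℝ (potential p) x :=
  (contDiffAt_potential hp hx).differentiableAt two_ne_zero

theorem continuousAt_gradient_potential (hp : ContMDiff (𝓡 n) 𝓘(ℝ, ℝ) 2 p.1) {x : Space n}
    (hx : x ≠ 0) : ContinuousAt (gradient (potential p)) x := by
  have h := ((contDiffAt_potential hp hx).fderiv_right (m := 1) le_rfl).continuousAt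
  exact (InnerProductSpace.toDual ℝ (Space n)).symm.continuous.continuousAt.comp h

theorem le_potential (hmin : ∀ s, Vmin ≤ p.1 s) {x : Space n} (hx : x ≠ 0) :
    Vmin / ‖x‖ ^ p.2 ≤ potential p x := by
  rw [potential_of_ne hx]
  exact div_le_div_of_nonneg_right (hmin _) (Real.rpow_nonneg (norm_nonneg _) _)

theorem direction_smul {r : ℝ} (hr : 0 < r) (ξ : UnitSphere n) (h : r • (ξ : Space n) ≠ 0) :
    direction (r • (ξ : Space n)) h = ξ := by
  apply Subtype.ext
  simp [direction, norm_smul, smul_smul, abs_of_pos hr, hr.ne']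

theorem smul_sphere_ne_zero {r : ℝ} (hr : r ≠ 0) (ξ : UnitSphere n) : r • (ξ : Space n) ≠ 0 :=
  smul_ne_zero hr (ne_zero_of_mem_unit_sphere ξ)

theorem norm_smul_sphere {r : ℝ} (hr : 0 ≤ r) (ξ : UnitSphere n) : ‖r • (ξ : Space n)‖ = r := by
  simp [norm_smul, abs_of_nonneg hr]

theorem potential_smul {r : ℝ} (hr : 0 < r) (ξ : UnitSphere n) :
    potential p (r • (ξ : Space n)) = p.1 ξ / r ^ p.2 := by
  rw [potential_of_ne (smul_sphere_ne_zero hr.ne' ξ), direction_smul hr, norm_smul_sphere hr.le]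

theorem hasGradientAt_norm_rpow (c q : ℝ) {x : Space n} (hx : x ≠ 0) :
    HasGradientAt (fun y : Space n => c / ‖y‖ ^ q) ((-(q * c) * ‖x‖ ^ (-q - 2)) • x) x := by
  have hpos : 0 < ‖x‖ := norm_pos_iff.2 hx
  have h1 : HasFDerivAt (fun y : Space n => ‖y‖ ^ 2) (2 • (innerSL ℝ x)) x :=
    (hasStrictFDerivAt_norm_sq x).hasFDerivAt
  have h2 := (h1.rpow_const (p := -q / 2) (Or.inl (by positivity))).const_mul c
  rw [hasGradientAt_iff_hasFDerivAt]
  have heq : (fun y : Space n => c / ‖y‖ ^ q) = fun y => c * (‖y‖ ^ 2) ^ (-q / 2) := by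
    funext y
    rw [← Real.rpow_natCast, ← Real.rpow_mul (norm_nonneg _), div_eq_mul_inv,
      ← Real.rpow_neg (norm_nonneg _)]
    congr 2
    push_cast; ring
  rw [heq]
  have hpow : (‖x‖ ^ 2) ^ (-q / 2 - 1) = ‖x‖ ^ (-q - 2) := by
    rw [← Real.rpow_natCast, ← Real.rpow_mul (norm_nonneg _)]
    congr 1
    push_cast; ring
  refine h2.congr_fderiv ?_
  rw [hpow]
  ext y
  simp
  ring

/-- The difference `V(y) - Vmin/|y|^α` is nonnegative and vanishes along the ray through `ξ`, so its
gradient is zero there. The force on that ray is thus the Keplerian one, and no tangential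
derivative on the sphere has to be computed. -/
theorem gradient_potential_smul (hp : ContMDiff (𝓡 n) 𝓘(ℝ, ℝ) 2 p.1)
    (hmin : ∀ s, Vmin ≤ p.1 s) {ξ : UnitSphere n} (hξ : p.1 ξ = Vmin) {r : ℝ} (hr : 0 < r) :
    gradient (potential p) (r • (ξ : Space n)) =
      (-(p.2 * Vmin) * r ^ (-p.2 - 1)) • (ξ : Space n) := by
  have hne := smul_sphere_ne_zero hr.ne' ξ
  have h1 := (differentiableAt_potential hp hne).hasGradientAt
  have h2 := hasGradientAt_norm_rpow Vmin p.2 hne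
  rw [hasGradientAt_iff_hasFDerivAt] at h1 h2
  have hloc : IsLocalMin (fun y => potential p y - Vmin / ‖y‖ ^ p.2) (r • (ξ : Space n)) := by
    filter_upwards [isOpen_compl_singleton.mem_nhds hne] with y hy
    rw [potential_smul hr, hξ, norm_smul_sphere hr.le, sub_self]
    exact sub_nonneg.2 (le_potential hmin hy)
  have h3 := hloc.hasFDerivAt_eq_zero (h1.sub h2)
  rw [sub_eq_zero] at h3
  have h4 := (InnerProductSpace.toDual ℝ (Space n)).injective h3
  rw [h4, norm_smul_sphere hr.le, smul_smul]
  congr 1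
  rw [mul_assoc]
  congr 1
  rw [show (-p.2 - 1 : ℝ) = (-p.2 - 2) + 1 by ring, Real.rpow_add hr, Real.rpow_one]

theorem singularPotential_of_ne {x : Space n} (hx : x ≠ 0) :
    singularPotential p x = ENNReal.ofReal (potential p x) := by
  rw [singularPotential, if_neg hx]

theorem singularPotential_zero : singularPotential p (0 : Space n) = ⊤ := by
  rw [singularPotential, if_pos rfl]

theorem continuousOn_potential (hp : ContMDiff (𝓡 n) 𝓘(ℝ, ℝ) 2 p.1) :
    ContinuousOn (potential p) ({0}ᶜ : Set (Space n)) := fun _ hx =>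
  (contDiffAt_potential hp hx).continuousAt.continuousWithinAt

theorem measurable_singularPotential (hp : ContMDiff (𝓡 n) 𝓘(ℝ, ℝ) 2 p.1) :
    Measurable (singularPotential (n := n) p) := by
  classical
  have h : Measurable (fun x : Space n => potential p x) := by
    have := (continuousOn_potential hp).measurable_piecewise (g := fun _ => (0 : ℝ))
      continuousOn_const (measurableSet_singleton (0 : Space n)).compl
    convert this using 1
    funext x
    by_cases hx : x = 0
    · simp [hx, potential]
    · simp [hx]
  exact Measurable.ite (measurableSet_singleton (0 : Space n)) measurable_const h.ennreal_ofReal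

end AnisotropicKepler

namespace AnisotropicKepler

variable {n : ℕ} {ξm ξp : UnitSphere n} {Vmin : ℝ} {p : (UnitSphere n → ℝ) × ℝ}
  {a b : ℝ} {x : ℝ → Space n}

/-! ### Lower bound of the action by the radial cost -/

/-- The least action needed to join a sphere of radius `r` to the origin. -/
noncomputable def radialCost (Vmin α r : ℝ) : ℝ := 2 * √(2 * Vmin) / (2 - α) * r ^ (1 - α / 2)

theorem radialCost_one (Vmin α : ℝ) : radialCost Vmin α 1 = 2 * √(2 * Vmin) / (2 - α) := by
  simp [radialCost]

theorem radialCost_zero (Vmin : ℝ) {α : ℝ} (hα : α < 2) : radialCost Vmin α 0 = 0 := by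
  rw [radialCost, Real.zero_rpow (by linarith), mul_zero]

theorem continuous_radialCost (Vmin : ℝ) {α : ℝ} (hα : α < 2) :
    Continuous (radialCost Vmin α) :=
  continuous_const.mul (continuous_id.rpow_const fun _ => Or.inr (by linarith))

theorem hasDerivAt_radialCost (Vmin : ℝ) {α : ℝ} (hα : α < 2) {r : ℝ} (hr : 0 < r) :
    HasDerivAt (radialCost Vmin α) (√(2 * Vmin) * r ^ (-(α / 2))) r := by
  have h := (Real.hasDerivAt_rpow_const (p := 1 - α / 2) (Or.inl hr.ne')).const_mul
    (2 * √(2 * Vmin) / (2 - α))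
  refine h.congr_deriv ?_
  rw [show 1 - α / 2 - 1 = -(α / 2) by ring]
  have : 2 - α ≠ 0 := by linarith
  field_simp

theorem strictMonoOn_radialCost {Vmin : ℝ} (hV : 0 < Vmin) {α : ℝ} (hα : α < 2) :
    StrictMonoOn (radialCost Vmin α) (Ici 0) := by
  intro r hr s _ hrs
  unfold radialCost
  have h1 : 0 < 2 * √(2 * Vmin) / (2 - α) := by
    have : 0 < 2 - α := by linarith
    positivity
  exact mul_lt_mul_of_pos_left (Real.rpow_lt_rpow hr hrs (by linarith)) h1

theorem tendsto_radialCost_atTop {Vmin : ℝ} (hV : 0 < Vmin) {α : ℝ} (hα : α < 2) :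
    Tendsto (radialCost Vmin α) atTop atTop := by
  have h1 : 0 < 2 * √(2 * Vmin) / (2 - α) := by
    have : 0 < 2 - α := by linarith
    positivity
  exact (tendsto_rpow_atTop (by linarith)).const_mul_atTop h1

/-- The derivative of the radial cost blows up at `0`. Shifting the radius by `ε` makes the cost
Lipschitz, so that its composition with an `H¹` path is absolutely continuous even through a
collision. -/
theorem lipschitzWith_radialCost_norm_add {Vmin : ℝ} {α : ℝ} (hα0 : 0 < α)
    (hα : α < 2) {ε : ℝ} (hε : 0 < ε) :
    LipschitzWith (√(2 * Vmin) * ε ^ (-(α / 2))).toNNReal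
      (fun y : Space n => radialCost Vmin α (‖y‖ + ε)) := by
  have hC : 0 ≤ √(2 * Vmin) * ε ^ (-(α / 2)) := by positivity
  refine LipschitzWith.of_dist_le_mul fun y z => ?_
  rw [Real.coe_toNNReal _ hC]
  have h := (convex_Ici ε).norm_image_sub_le_of_norm_hasDerivWithin_le
    (f := radialCost Vmin α) (f' := fun r => √(2 * Vmin) * r ^ (-(α / 2)))
    (C := √(2 * Vmin) * ε ^ (-(α / 2))) (x := ‖z‖ + ε) (y := ‖y‖ + ε)
    (fun r hr => (hasDerivAt_radialCost Vmin hα (hε.trans_le hr)).hasDerivWithinAt)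
    (fun r hr => by
      have hr0 : 0 < r := hε.trans_le hr
      rw [Real.norm_of_nonneg (by positivity)]
      gcongr 1
      exact Real.rpow_le_rpow_of_nonpos hε hr (by linarith))
    (mem_Ici.2 (le_add_of_nonneg_left (norm_nonneg z)))
    (mem_Ici.2 (le_add_of_nonneg_left (norm_nonneg y)))
  rw [Real.dist_eq, dist_eq_norm, ← Real.norm_eq_abs]
  refine h.trans ?_
  gcongr
  rw [add_sub_add_right_eq_sub]
  exact abs_norm_sub_norm_le y z

/-- This is Young's inequality `cv ≤ v²/2 + c²/2` with `c = √(2Vmin) |x|^(-α/2)` and `v = |ẋ|`. The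
shift by `ε` only lowers the left side, the exponent being negative, and at a collision the right
side is infinite. -/
theorem enorm_deriv_radialCost_le (hV : 0 < Vmin) (hmin : ∀ s, Vmin ≤ p.1 s) (hα0 : 0 < p.2)
    (hα : p.2 < 2) {ε : ℝ} (hε : 0 < ε) {t : ℝ} (hx : DifferentiableAt ℝ x t) :
    ‖deriv (fun s => radialCost Vmin p.2 (‖x s‖ + ε)) t‖ₑ ≤
      ENNReal.ofReal (1 / 2 * ‖deriv x t‖ ^ 2) + singularPotential p (x t) := by
  by_cases h0 : x t = 0
  · rw [h0, singularPotential_zero, add_top]; exact le_top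
  have hpos : 0 < ‖x t‖ := norm_pos_iff.2 h0
  have hnorm : HasFDerivAt (fun y : Space n => ‖y‖) (fderiv ℝ (fun y : Space n => ‖y‖) (x t))
      (x t) := ((contDiffAt_norm ℝ h0 (n := 1)).differentiableAt one_ne_zero).hasFDerivAt
  have h1 := (hnorm.comp_hasDerivAt t hx.hasDerivAt).add_const ε
  have h2 := (hasDerivAt_radialCost Vmin hα (r := ‖x t‖ + ε) (by positivity)).comp t h1
  have h2' : deriv (fun s => radialCost Vmin p.2 (‖x s‖ + ε)) t = _ := h2.deriv
  have hd : |fderiv ℝ (fun y : Space n => ‖y‖) (x t) (deriv x t)| ≤ ‖deriv x t‖ := by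
    rw [← Real.norm_eq_abs]
    refine (ContinuousLinearMap.le_opNorm _ _).trans ?_
    have := norm_fderiv_le_of_lipschitz ℝ (lipschitzWith_one_norm (E := Space n)) (x₀ := x t)
    simpa using mul_le_mul_of_nonneg_right this (norm_nonneg (deriv x t))
  rw [singularPotential_of_ne h0, ← ENNReal.ofReal_add (by positivity)
    ((by positivity : 0 ≤ Vmin / ‖x t‖ ^ p.2).trans (le_potential hmin h0)),
    ← ofReal_norm]
  refine ENNReal.ofReal_le_ofReal ?_
  rw [h2', Real.norm_eq_abs, abs_mul, abs_of_nonneg (by positivity)]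
  have h3 : √(2 * Vmin) * (‖x t‖ + ε) ^ (-(p.2 / 2)) ≤ √(2 * Vmin) * ‖x t‖ ^ (-(p.2 / 2)) := by
    gcongr 1
    exact Real.rpow_le_rpow_of_nonpos hpos (by linarith) (by linarith)
  have h4 : (√(2 * Vmin) * ‖x t‖ ^ (-(p.2 / 2))) ^ 2 = 2 * (Vmin / ‖x t‖ ^ p.2) := by
    rw [mul_pow, Real.sq_sqrt (by positivity), ← Real.rpow_natCast, ← Real.rpow_mul hpos.le,
      show -(p.2 / 2) * ((2 : ℕ) : ℝ) = -p.2 by push_cast; ring, Real.rpow_neg hpos.le]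
    ring
  calc _ ≤ (√(2 * Vmin) * ‖x t‖ ^ (-(p.2 / 2))) * ‖deriv x t‖ := by
        gcongr
    _ ≤ 1 / 2 * ‖deriv x t‖ ^ 2 + Vmin / ‖x t‖ ^ p.2 := by
        nlinarith [sq_nonneg (√(2 * Vmin) * ‖x t‖ ^ (-(p.2 / 2)) - ‖deriv x t‖)]
    _ ≤ _ := by
        gcongr
        exact le_potential hmin h0

/-- The pointwise bound is integrated for each shift `ε`; the right side does not depend on `ε`, so
`ε` may tend to `0`. -/
theorem ofReal_abs_radialCost_sub_le_action (hV : 0 < Vmin) (hmin : ∀ s, Vmin ≤ p.1 s)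
    (hα0 : 0 < p.2) (hα : p.2 < 2) (hab : a ≤ b) (hx : IsH1 a b x) :
    ENNReal.ofReal |radialCost Vmin p.2 ‖x b‖ - radialCost Vmin p.2 ‖x a‖| ≤ action p a b x := by
  have hreg : ∀ ε : ℝ, 0 < ε → ENNReal.ofReal
      |radialCost Vmin p.2 (‖x b‖ + ε) - radialCost Vmin p.2 (‖x a‖ + ε)| ≤ action p a b x := by
    intro ε hε
    have hac : AbsolutelyContinuousOnInterval (fun s => radialCost Vmin p.2 (‖x s‖ + ε)) a b :=
      (lipschitzWith_radialCost_norm_add (n := n) (Vmin := Vmin) hα0 hα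
        hε).comp_absolutelyContinuousOnInterval hx.1
    have hint := hac.integral_deriv_eq_sub
    rw [← hint, ← Real.norm_eq_abs, ofReal_norm,
      intervalIntegral.integral_of_le hab, ← restrict_Ioo_eq_restrict_Ioc]
    refine (enorm_integral_le_lintegral_enorm _).trans (lintegral_mono_ae ?_)
    filter_upwards [hx.ae_differentiableAt hab] with t ht
    exact enorm_deriv_radialCost_le hV hmin hα0 hα hε ht
  have hlim : Tendsto (fun ε : ℝ => ENNReal.ofReal
      |radialCost Vmin p.2 (‖x b‖ + ε) - radialCost Vmin p.2 (‖x a‖ + ε)|) (𝓝[>] 0)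
      (𝓝 (ENNReal.ofReal |radialCost Vmin p.2 ‖x b‖ - radialCost Vmin p.2 ‖x a‖|)) := by
    have hc := continuous_radialCost Vmin hα
    have : Continuous fun ε : ℝ => ENNReal.ofReal
      |radialCost Vmin p.2 (‖x b‖ + ε) - radialCost Vmin p.2 (‖x a‖ + ε)| :=
      ENNReal.continuous_ofReal.comp (by fun_prop)
    simpa using (this.tendsto 0).mono_left nhdsWithin_le_nhds
  exact le_of_tendsto hlim (by filter_upwards [self_mem_nhdsWithin] with ε hε using hreg ε hε)

theorem action_add {c : ℝ} (hac : a ≤ c) (hcb : c ≤ b) :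
    action p a c x + action p c b x = action p a b x := by
  unfold action
  simp only [restrict_Ioo_eq_restrict_Ioc]
  rw [← Ioc_union_Ioc_eq_Ioc hac hcb, lintegral_union measurableSet_Ioc]
  exact Set.disjoint_left.2 fun t h1 h2 => absurd h1.2 (not_le.2 h2.1)

/-- Both endpoints have norm `1`, so the piece before `t` and the piece after `t` each pay the same
radial difference. -/
theorem IsAdmissible.two_mul_radialCost_sub_le (hV : 0 < Vmin) (hmin : ∀ s, Vmin ≤ p.1 s)
    (hα0 : 0 < p.2) (hα : p.2 < 2) (hx : IsAdmissible ξm ξp a b x) {t : ℝ} (ht : t ∈ Icc a b) :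
    ENNReal.ofReal (2 * |radialCost Vmin p.2 ‖x t‖ - radialCost Vmin p.2 1|) ≤
      action p a b x := by
  have h1 := ofReal_abs_radialCost_sub_le_action hV hmin hα0 hα ht.1
    (hx.isH1.mono le_rfl ht.1 ht.2)
  have h2 := ofReal_abs_radialCost_sub_le_action hV hmin hα0 hα ht.2
    (hx.isH1.mono ht.1 ht.2 le_rfl)
  rw [hx.left, norm_eq_of_mem_sphere] at h1
  rw [hx.right, norm_eq_of_mem_sphere, abs_sub_comm] at h2
  rw [two_mul, ENNReal.ofReal_add (abs_nonneg _) (abs_nonneg _), ← action_add ht.1 ht.2]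
  exact add_le_add h1 h2

/-- A path of action below the collision threshold stays in an annulus that depends only on the
action. -/
theorem exists_annulus (hV : 0 < Vmin) (hmin : ∀ s, Vmin ≤ p.1 s) (hα0 : 0 < p.2) (hα : p.2 < 2)
    {A : ℝ≥0∞} (hA : A < ENNReal.ofReal (4 * √(2 * Vmin) / (2 - p.2))) :
    ∃ ρ R : ℝ, 0 < ρ ∧ 0 < R ∧ ∀ (ξm ξp : UnitSphere n) (a b : ℝ) (x : ℝ → Space n),
      IsAdmissible ξm ξp a b x → action p a b x ≤ A →
        ∀ t ∈ Icc a b, ρ ≤ ‖x t‖ ∧ ‖x t‖ ≤ R := by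
  have hAtop : A ≠ ⊤ := ne_top_of_lt hA
  set A' := A.toReal with hA'
  have hAA : A = ENNReal.ofReal A' := (ENNReal.ofReal_toReal hAtop).symm
  have hlt : A' < 2 * radialCost Vmin p.2 1 := by
    rw [hAA] at hA
    have h2 := (ENNReal.ofReal_lt_ofReal_iff_of_nonneg ENNReal.toReal_nonneg).1 hA
    rw [radialCost_one]
    convert h2 using 1
    ring
  have hkey : ∀ (ξm ξp : UnitSphere n) (a b : ℝ) (x : ℝ → Space n),
      IsAdmissible ξm ξp a b x → action p a b x ≤ A → ∀ t ∈ Icc a b,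
        2 * |radialCost Vmin p.2 ‖x t‖ - radialCost Vmin p.2 1| ≤ A' := by
    intro ξm ξp a b x hx hact t ht
    have h := (hx.two_mul_radialCost_sub_le hV hmin hα0 hα ht).trans hact
    exact ENNReal.ofReal_le_iff_le_toReal hAtop |>.1 h
  -- The gap `Φ(1) - A'/2` is positive precisely because `A` lies below the threshold, while `Φ`
  -- vanishes continuously at `0`.
  obtain ⟨ρ, hρ0, hρ⟩ : ∃ ρ > 0, radialCost Vmin p.2 ρ < radialCost Vmin p.2 1 - A' / 2 := by
    have hc := (continuous_radialCost Vmin hα).tendsto 0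
    rw [radialCost_zero Vmin hα] at hc
    have h := (hc.mono_left (nhdsWithin_le_nhds (s := Ioi 0))).eventually_lt_const
      (show 0 < radialCost Vmin p.2 1 - A' / 2 by linarith)
    obtain ⟨ρ, h1, h2⟩ := (h.and self_mem_nhdsWithin).exists
    exact ⟨ρ, h2, h1⟩
  obtain ⟨R, hR, hR0⟩ := (((tendsto_radialCost_atTop hV hα).eventually_gt_atTop
    (radialCost Vmin p.2 1 + A' / 2)).and (eventually_gt_atTop 0)).exists
  refine ⟨ρ, R, hρ0, hR0, fun ξm ξp a b x hx hact t ht => ?_⟩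
  have h := abs_le.1 (show |radialCost Vmin p.2 ‖x t‖ - radialCost Vmin p.2 1| ≤ A' / 2 by
    linarith [hkey ξm ξp a b x hx hact t ht])
  have hmono := strictMonoOn_radialCost hV hα
  constructor
  · rw [← hmono.le_iff_le (mem_Ici.2 hρ0.le) (mem_Ici.2 (norm_nonneg _))]; linarith [h.1]
  · rw [← hmono.le_iff_le (mem_Ici.2 (norm_nonneg _)) (mem_Ici.2 hR0.le)]; linarith [h.2]

end AnisotropicKepler

namespace AnisotropicKepler

variable {n : ℕ} {ξm ξp : UnitSphere n} {Vmin : ℝ} {p : (UnitSphere n → ℝ) × ℝ}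

/-! ### The collision path made of two homothetic motions -/

theorem intervalIntegrable_abs_rpow_zero {q : ℝ} (hq : -1 < q) {τ : ℝ} (hτ : 0 ≤ τ) :
    IntervalIntegrable (fun t : ℝ => |t| ^ q) volume 0 τ := by
  refine (intervalIntegral.intervalIntegrable_rpow' hq (a := 0) (b := τ)).congr fun t ht => ?_
  rw [uIoc_of_le hτ] at ht
  simp [abs_of_pos ht.1]

theorem intervalIntegrable_abs_rpow {q : ℝ} (hq : -1 < q) {τ : ℝ} (hτ : 0 ≤ τ) :
    IntervalIntegrable (fun t : ℝ => |t| ^ q) volume (-τ) τ := by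
  have h := intervalIntegrable_abs_rpow_zero hq hτ
  have h' := h.comp_mul_left (c := -1)
  simp only [neg_mul, one_mul, abs_neg, div_neg, div_one, neg_zero] at h'
  exact h'.symm.trans h

theorem integral_abs_rpow {q : ℝ} (hq : -1 < q) {τ : ℝ} (hτ : 0 ≤ τ) :
    ∫ t in (-τ)..τ, |t| ^ q = 2 * (τ ^ (q + 1) / (q + 1)) := by
  have h := intervalIntegrable_abs_rpow_zero hq hτ
  have hI := intervalIntegrable_abs_rpow hq hτ
  have h0 : ∫ t in (0 : ℝ)..τ, |t| ^ q = τ ^ (q + 1) / (q + 1) := by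
    have : ∫ t in (0 : ℝ)..τ, |t| ^ q = ∫ t in (0 : ℝ)..τ, t ^ q := by
      refine intervalIntegral.integral_congr fun t ht => ?_
      rw [uIcc_of_le hτ] at ht
      simp [abs_of_nonneg ht.1]
    rw [this, integral_rpow (Or.inl hq), Real.zero_rpow (by linarith), sub_zero]
  have h1 : ∫ t in (-τ)..0, |t| ^ q = τ ^ (q + 1) / (q + 1) := by
    have := intervalIntegral.integral_comp_neg (a := 0) (b := τ) (fun t : ℝ => |t| ^ q)
    simp only [abs_neg, neg_zero] at this
    rw [← this, h0]
  rw [← intervalIntegral.integral_add_adjacent_intervals (b := 0)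
    (hI.mono_set (uIcc_subset_uIcc left_mem_uIcc (by
      rw [uIcc_of_le (by linarith)]; exact ⟨by linarith, hτ⟩))) h, h0, h1]
  ring

/-- The rate at which `|x|^(1 + α/2)` grows along a zero-energy homothetic motion. -/
noncomputable def collisionRate (Vmin α : ℝ) : ℝ := (1 + α / 2) * √(2 * Vmin)

/-- The juxtaposition at time `0` of the two zero-energy homothetic motions. -/
noncomputable def collisionPath (ξm ξp : UnitSphere n) (Vmin α t : ℝ) : Space n :=
  (collisionRate Vmin α * |t|) ^ (2 / (2 + α)) • (if t ≤ 0 then (ξm : Space n) else ξp)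

/-- The velocity of `collisionPath`. -/
noncomputable def collisionVelocity (ξm ξp : UnitSphere n) (Vmin α t : ℝ) : Space n :=
  (√(2 * Vmin) * (collisionRate Vmin α * |t|) ^ (-(α / (2 + α)))) •
    (if t ≤ 0 then -(ξm : Space n) else ξp)

theorem collisionRate_pos (hV : 0 < Vmin) {α : ℝ} (hα : 0 < α) : 0 < collisionRate Vmin α := by
  unfold collisionRate; positivity

/-- Zero energy along the ray means `|ṙ| = √(2Vmin) r^(-α/2)`, which integrates to `r^(1+α/2) =
collisionRate · |t|`. The sign `σ` treats both halves at once: `|t| = σ t`, with `σ = -1` before the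
collision and `σ = 1` after it. -/
theorem hasDerivAt_collisionRadius (hV : 0 < Vmin) {α : ℝ} (hα : 0 < α) {σ t : ℝ}
    (ht : 0 < σ * t) :
    HasDerivAt (fun s => (collisionRate Vmin α * (σ * s)) ^ (2 / (2 + α)))
      (√(2 * Vmin) * (collisionRate Vmin α * (σ * t)) ^ (-(α / (2 + α))) * σ) t := by
  have hc := collisionRate_pos hV hα
  have h1 : HasDerivAt (fun s => collisionRate Vmin α * (σ * s)) (collisionRate Vmin α * σ) t := by
    simpa using ((hasDerivAt_id t).const_mul σ).const_mul (collisionRate Vmin α)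
  have h2 := h1.rpow_const (p := 2 / (2 + α)) (Or.inl (by positivity))
  refine h2.congr_deriv ?_
  rw [show 2 / (2 + α) - 1 = -(α / (2 + α)) by field_simp; ring]
  have : collisionRate Vmin α * (2 / (2 + α)) = √(2 * Vmin) := by
    unfold collisionRate; field_simp
  rw [← this]; ring

/-- The radial acceleration is put in the form `-(α Vmin) r^(-α-1)`, to match the force given by
`gradient_potential_smul`; only `σ² = 1` enters, so it does not depend on the branch. -/
theorem hasDerivAt_collisionSpeed (hV : 0 < Vmin) {α : ℝ} (hα : 0 < α) {σ t : ℝ}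
    (hσ : σ = 1 ∨ σ = -1) (ht : 0 < σ * t) :
    HasDerivAt (fun s => √(2 * Vmin) * (collisionRate Vmin α * (σ * s)) ^ (-(α / (2 + α))) * σ)
      (-(α * Vmin) * ((collisionRate Vmin α * (σ * t)) ^ (2 / (2 + α))) ^ (-α - 1)) t := by
  have hc := collisionRate_pos hV hα
  have h1 : HasDerivAt (fun s => collisionRate Vmin α * (σ * s)) (collisionRate Vmin α * σ) t := by
    simpa using ((hasDerivAt_id t).const_mul σ).const_mul (collisionRate Vmin α)
  have h2 := ((h1.rpow_const (p := -(α / (2 + α))) (Or.inl (by positivity))).const_mul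
    (√(2 * Vmin))).mul_const σ
  refine h2.congr_deriv ?_
  rw [← Real.rpow_mul (by positivity),
    show -(α / (2 + α)) - 1 = 2 / (2 + α) * (-α - 1) by field_simp; ring]
  have hs : √(2 * Vmin) * √(2 * Vmin) = 2 * Vmin := Real.mul_self_sqrt (by positivity)
  have hσ2 : σ * σ = 1 := by rcases hσ with rfl | rfl <;> norm_num
  have h3 : √(2 * Vmin) * (collisionRate Vmin α * σ * -(α / (2 + α))) * σ = -(α * Vmin) := by
    unfold collisionRate
    have h2α : 2 + α ≠ 0 := by positivity
    calc _ = (√(2 * Vmin) * √(2 * Vmin)) * (σ * σ) * ((1 + α / 2) * -(α / (2 + α))) := by ring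
      _ = _ := by rw [hs, hσ2]; field_simp
  rw [← h3]; ring

theorem eventually_sign_mul_pos {σ t : ℝ} (ht : 0 < σ * t) : ∀ᶠ s in 𝓝 t, 0 < σ * s :=
  (continuous_const.mul continuous_id).continuousAt.eventually_const_lt ht

theorem collisionPath_eq {α σ t : ℝ} {ξ : UnitSphere n} (h : σ = 1 ∧ ξ = ξp ∨ σ = -1 ∧ ξ = ξm)
    (ht : 0 < σ * t) :
    collisionPath ξm ξp Vmin α t =
      (collisionRate Vmin α * (σ * t)) ^ (2 / (2 + α)) • (ξ : Space n) := by
  rcases h with ⟨rfl, rfl⟩ | ⟨rfl, rfl⟩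
  · rw [one_mul] at ht
    simp [collisionPath, abs_of_pos ht, not_le.2 ht]
  · have : t < 0 := by linarith
    simp [collisionPath, abs_of_neg this, this.le]

theorem collisionVelocity_eq {α σ t : ℝ} {ξ : UnitSphere n}
    (h : σ = 1 ∧ ξ = ξp ∨ σ = -1 ∧ ξ = ξm) (ht : 0 < σ * t) :
    collisionVelocity ξm ξp Vmin α t =
      (√(2 * Vmin) * (collisionRate Vmin α * (σ * t)) ^ (-(α / (2 + α))) * σ) • (ξ : Space n) := by
  rcases h with ⟨rfl, rfl⟩ | ⟨rfl, rfl⟩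
  · rw [one_mul] at ht
    simp [collisionVelocity, abs_of_pos ht, not_le.2 ht]
  · have : t < 0 := by linarith
    simp [collisionVelocity, abs_of_neg this, this.le]

theorem hasDerivAt_collisionPath (hV : 0 < Vmin) {α : ℝ} (hα : 0 < α) {σ t : ℝ} {ξ : UnitSphere n}
    (h : σ = 1 ∧ ξ = ξp ∨ σ = -1 ∧ ξ = ξm) (ht : 0 < σ * t) :
    HasDerivAt (collisionPath ξm ξp Vmin α) (collisionVelocity ξm ξp Vmin α t) t := by
  rw [collisionVelocity_eq h ht]
  refine ((hasDerivAt_collisionRadius hV hα ht).smul_const (ξ : Space n)).congr_of_eventuallyEq ?_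
  filter_upwards [eventually_sign_mul_pos ht] with s hs
  exact collisionPath_eq h hs

theorem exists_sign {t : ℝ} (ht : t ≠ 0) (ξm ξp : UnitSphere n) :
    ∃ (σ : ℝ) (ξ : UnitSphere n), (σ = 1 ∧ ξ = ξp ∨ σ = -1 ∧ ξ = ξm) ∧ 0 < σ * t := by
  rcases ht.lt_or_gt with h | h
  · exact ⟨-1, ξm, by simp, by linarith⟩
  · exact ⟨1, ξp, by simp, by linarith⟩

theorem hasDerivAt_deriv_collisionPath (hp : ContMDiff (𝓡 n) 𝓘(ℝ, ℝ) 2 p.1) (hV : 0 < Vmin)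
    (hmin : ∀ s, Vmin ≤ p.1 s) (hξm : p.1 ξm = Vmin) (hξp : p.1 ξp = Vmin) (hα : 0 < p.2)
    {t : ℝ} (ht0 : t ≠ 0) :
    HasDerivAt (deriv (collisionPath ξm ξp Vmin p.2))
      (gradient (potential p) (collisionPath ξm ξp Vmin p.2 t)) t := by
  obtain ⟨σ, ξ, h, ht⟩ := exists_sign ht0 ξm ξp
  have hσ : σ = 1 ∨ σ = -1 := h.imp And.left And.left
  have hξ : p.1 ξ = Vmin := by rcases h with ⟨-, rfl⟩ | ⟨-, rfl⟩ <;> assumption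
  have hc := collisionRate_pos hV hα
  rw [collisionPath_eq h ht, gradient_potential_smul hp hmin hξ (by positivity)]
  refine ((hasDerivAt_collisionSpeed hV hα hσ ht).smul_const (ξ : Space n)).congr_of_eventuallyEq ?_
  filter_upwards [eventually_sign_mul_pos ht] with s hs
  rw [(hasDerivAt_collisionPath hV hα h hs).deriv, collisionVelocity_eq h hs]

theorem norm_collisionPath (hV : 0 < Vmin) {α : ℝ} (hα : 0 < α) (t : ℝ) :
    ‖collisionPath ξm ξp Vmin α t‖ = (collisionRate Vmin α * |t|) ^ (2 / (2 + α)) := by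
  have hc := collisionRate_pos hV hα
  unfold collisionPath
  split_ifs <;> exact norm_smul_sphere (by positivity) _

theorem collisionPath_zero (hα : 0 < p.2) : collisionPath ξm ξp Vmin p.2 0 = 0 := by
  rw [collisionPath, abs_zero, mul_zero, Real.zero_rpow (by positivity), zero_smul]

theorem collisionPath_ne_zero (hV : 0 < Vmin) {α : ℝ} (hα : 0 < α) {t : ℝ} (ht : t ≠ 0) :
    collisionPath ξm ξp Vmin α t ≠ 0 := by
  have hc := collisionRate_pos hV hα
  rw [← norm_ne_zero_iff, norm_collisionPath hV hα]
  positivity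

theorem continuous_collisionPath (hV : 0 < Vmin) {α : ℝ} (hα : 0 < α) :
    Continuous (collisionPath ξm ξp Vmin α) := by
  rw [continuous_iff_continuousAt]
  intro t
  by_cases ht : t = 0
  · subst ht
    have h0 : collisionPath ξm ξp Vmin α 0 = 0 := by
      rw [collisionPath, abs_zero, mul_zero, Real.zero_rpow (by positivity), zero_smul]
    rw [ContinuousAt, h0, tendsto_zero_iff_norm_tendsto_zero]
    simp_rw [norm_collisionPath hV hα]
    have hcont : Continuous fun t : ℝ => (collisionRate Vmin α * |t|) ^ (2 / (2 + α)) :=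
      (continuous_const.mul continuous_abs).rpow_const fun _ => Or.inr (by positivity)
    have := hcont.tendsto 0
    rwa [abs_zero, mul_zero, Real.zero_rpow (by positivity)] at this
  · obtain ⟨σ, ξ, h, hs⟩ := exists_sign ht ξm ξp
    exact (hasDerivAt_collisionPath hV hα h hs).continuousAt

theorem measurable_collisionVelocity (Vmin α : ℝ) :
    Measurable (collisionVelocity ξm ξp Vmin α) := by
  have h1 : Measurable fun t : ℝ =>
      √(2 * Vmin) * (collisionRate Vmin α * |t|) ^ (-(α / (2 + α))) :=
    measurable_const.mul ((measurable_const.mul measurable_id.abs).pow_const _)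
  exact h1.smul (Measurable.ite measurableSet_Iic measurable_const measurable_const)

theorem norm_collisionVelocity_sq (hV : 0 < Vmin) {α : ℝ} (hα : 0 < α) (t : ℝ) :
    ‖collisionVelocity ξm ξp Vmin α t‖ ^ 2 =
      2 * Vmin * (collisionRate Vmin α ^ (-(2 * α / (2 + α))) * |t| ^ (-(2 * α / (2 + α)))) := by
  have hc := collisionRate_pos hV hα
  have h1 : ‖if t ≤ 0 then -(ξm : Space n) else ξp‖ = 1 := by split_ifs <;> simp
  rw [collisionVelocity, norm_smul, h1, mul_one, Real.norm_eq_abs, sq_abs, mul_pow,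
    Real.sq_sqrt (by positivity), ← Real.mul_rpow hc.le (abs_nonneg t), ← Real.rpow_natCast,
    ← Real.rpow_mul (by positivity)]
  congr 2
  push_cast; ring

/-- Along the collision path the squared speed is a multiple of `|t|` to this power; its
integrability at the collision is where `α < 2` enters. -/
theorem neg_one_lt_collision_exponent {α : ℝ} (hα : 0 < α) (hα2 : α < 2) :
    -1 < -(2 * α / (2 + α)) := by
  rw [neg_lt_neg_iff, div_lt_one (by linarith)]
  linarith

theorem memLp_collisionVelocity (hV : 0 < Vmin) {α : ℝ} (hα : 0 < α) (hα2 : α < 2) {τ : ℝ}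
    (hτ : 0 < τ) :
    MemLp (collisionVelocity ξm ξp Vmin α) 2 (volume.restrict (Ioo (-τ) τ)) := by
  rw [memLp_two_iff_integrable_sq_norm (measurable_collisionVelocity Vmin α).aestronglyMeasurable]
  simp_rw [norm_collisionVelocity_sq hV hα]
  have := ((intervalIntegrable_abs_rpow (neg_one_lt_collision_exponent hα hα2) hτ.le).const_mul
    (collisionRate Vmin α ^ (-(2 * α / (2 + α))))).const_mul (2 * Vmin)
  rwa [intervalIntegrable_iff_integrableOn_Ioo_of_le (by linarith)] at this

theorem isAdmissible_collisionPath (hV : 0 < Vmin) {α : ℝ} (hα : 0 < α) (hα2 : α < 2) :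
    IsAdmissible ξm ξp (-(collisionRate Vmin α)⁻¹) (collisionRate Vmin α)⁻¹
      (collisionPath ξm ξp Vmin α) := by
  have hc := collisionRate_pos hV hα
  have hτ : 0 < (collisionRate Vmin α)⁻¹ := by positivity
  have hv := memLp_collisionVelocity (ξm := ξm) (ξp := ξp) hV hα hα2 hτ
  refine ⟨by linarith, isH1_of_eq_integral (by linarith) hv fun t ht => ?_, ?_, ?_⟩
  -- The velocity blows up at the collision, but the fundamental theorem tolerates a countable
  -- exceptional set when the path is continuous and the velocity integrable.
  · rw [integral_eq_of_hasDerivAt_off_countable (collisionPath ξm ξp Vmin α) _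
      (countable_singleton (0 : ℝ)) (continuous_collisionPath hV hα).continuousOn]
    · abel
    · intro s hs
      obtain ⟨σ, ξ, h, hs⟩ := exists_sign (t := s) (by simpa using hs.2) ξm ξp
      exact hasDerivAt_collisionPath hV hα h hs
    · refine (intervalIntegrable_of_memLp_Ioo hv (by linarith)).mono_set ?_
      rw [uIcc_of_le ht.1, uIcc_of_le (by linarith)]
      exact Icc_subset_Icc le_rfl ht.2
  · rw [collisionPath_eq (σ := -1) (ξ := ξm) (Or.inr ⟨rfl, rfl⟩) (by simpa using hτ)]
    simp [hc.ne']
  · rw [collisionPath_eq (σ := 1) (ξ := ξp) (Or.inl ⟨rfl, rfl⟩) (by simpa using hτ)]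
    simp [hc.ne']

theorem isDoubleHomothetic_collisionPath (hp : ContMDiff (𝓡 n) 𝓘(ℝ, ℝ) 2 p.1) (hV : 0 < Vmin)
    (hmin : ∀ s, Vmin ≤ p.1 s) (hξm : p.1 ξm = Vmin) (hξp : p.1 ξp = Vmin) (hα : 0 < p.2)
    (hα2 : p.2 < 2) :
    IsDoubleHomothetic ξm ξp p (-(collisionRate Vmin p.2)⁻¹) (collisionRate Vmin p.2)⁻¹
      (collisionPath ξm ξp Vmin p.2) := by
  have hc := collisionRate_pos hV hα
  have hτ : 0 < (collisionRate Vmin p.2)⁻¹ := by positivity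
  have hadm := isAdmissible_collisionPath (ξm := ξm) (ξp := ξp) hV hα hα2
  have hsol : ∀ t : ℝ, t ≠ 0 → collisionPath ξm ξp Vmin p.2 t ≠ 0 ∧
      DifferentiableAt ℝ (collisionPath ξm ξp Vmin p.2) t ∧
      HasDerivAt (deriv (collisionPath ξm ξp Vmin p.2))
        (gradient (potential p) (collisionPath ξm ξp Vmin p.2 t)) t := fun t ht => by
    obtain ⟨σ, ξ, h, hs⟩ := exists_sign ht ξm ξp
    exact ⟨collisionPath_ne_zero hV hα ht, (hasDerivAt_collisionPath hV hα h hs).differentiableAt,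
      hasDerivAt_deriv_collisionPath hp hV hmin hξm hξp hα ht⟩
  refine ⟨hadm.left, hadm.right, 0, ⟨by linarith, hτ⟩, collisionPath_zero hα,
    ⟨fun t ht => hsol t ht.2.ne, fun t ht => ?_⟩, ⟨fun t ht => hsol t ht.1.ne', fun t ht => ?_⟩⟩
  · rw [norm_collisionPath hV hα, collisionPath, if_pos ht.2]
  · rcases ht.1.eq_or_lt with h | h
    · rw [← h, collisionPath_zero hα]; simp
    · rw [norm_collisionPath hV hα, collisionPath, if_neg (not_le.2 h)]

/-- At zero energy the kinetic and potential terms coincide, so the integrand is twice the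
potential, an explicit power of `|t|`. The motion has unit radius at `|t| = 1/collisionRate`. -/
theorem action_collisionPath (hV : 0 < Vmin) (hξm : p.1 ξm = Vmin)
    (hξp : p.1 ξp = Vmin) (hα : 0 < p.2) (hα2 : p.2 < 2) :
    action p (-(collisionRate Vmin p.2)⁻¹) (collisionRate Vmin p.2)⁻¹
      (collisionPath ξm ξp Vmin p.2) = ENNReal.ofReal (4 * √(2 * Vmin) / (2 - p.2)) := by
  have hc := collisionRate_pos hV hα
  set c := collisionRate Vmin p.2 with hcdef
  set q := -(2 * p.2 / (2 + p.2)) with hq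
  have hq1 : -1 < q := neg_one_lt_collision_exponent hα hα2
  have hτ : 0 < c⁻¹ := by positivity
  have hpt : ∀ t : ℝ, t ≠ 0 → ENNReal.ofReal (1 / 2 * ‖deriv (collisionPath ξm ξp Vmin p.2) t‖ ^ 2)
      + singularPotential p (collisionPath ξm ξp Vmin p.2 t) =
      ENNReal.ofReal (2 * Vmin * (c ^ q * |t| ^ q)) := by
    intro t ht
    obtain ⟨σ, ξ, h, hs⟩ := exists_sign ht ξm ξp
    have hξ : p.1 ξ = Vmin := by rcases h with ⟨-, rfl⟩ | ⟨-, rfl⟩ <;> assumption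
    have habs : |t| = σ * t := by
      rcases h with ⟨rfl, -⟩ | ⟨rfl, -⟩
      · rw [one_mul] at hs ⊢; exact abs_of_pos hs
      · rw [neg_one_mul] at hs ⊢; exact abs_of_neg (by linarith)
    have hpot : potential p (collisionPath ξm ξp Vmin p.2 t) = Vmin * (c ^ q * |t| ^ q) := by
      rw [collisionPath_eq h hs, potential_smul (by positivity), hξ, div_eq_mul_inv,
        ← Real.rpow_mul (by positivity), ← Real.rpow_neg (by positivity), ← habs,
        ← Real.mul_rpow hc.le (abs_nonneg t)]
      congr 2
      rw [hq]; ring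
    rw [singularPotential_of_ne (collisionPath_ne_zero hV hα ht), hpot,
      (hasDerivAt_collisionPath hV hα h hs).deriv, norm_collisionVelocity_sq hV hα, ← hq, ← hcdef,
      ← ENNReal.ofReal_add (by positivity) (by positivity)]
    congr 1; ring
  have hI : IntegrableOn (fun t => 2 * Vmin * (c ^ q * |t| ^ q)) (Ioo (-c⁻¹) c⁻¹) := by
    have := ((intervalIntegrable_abs_rpow hq1 hτ.le).const_mul (c ^ q)).const_mul (2 * Vmin)
    rwa [intervalIntegrable_iff_integrableOn_Ioo_of_le (by linarith)] at this
  have hcongr : action p (-c⁻¹) c⁻¹ (collisionPath ξm ξp Vmin p.2) =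
      ∫⁻ t in Ioo (-c⁻¹) c⁻¹, ENNReal.ofReal (2 * Vmin * (c ^ q * |t| ^ q)) := by
    -- The instant of collision, where the integrand is infinite, is a null set.
    refine lintegral_congr_ae (ae_restrict_of_ae ?_)
    filter_upwards [compl_mem_ae_iff.2 (measure_singleton (0 : ℝ))] with t ht
    exact hpt t ht
  rw [hcongr, ← ofReal_integral_eq_lintegral_ofReal hI (ae_of_all _ fun t => by positivity),
    restrict_Ioo_eq_restrict_Ioc, ← intervalIntegral.integral_of_le (by linarith)]
  simp_rw [intervalIntegral.integral_const_mul]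
  rw [integral_abs_rpow hq1 hτ.le]
  congr 1
  have hq2 : q + 1 = (2 - p.2) / (2 + p.2) := by rw [hq]; field_simp; ring
  have h1 : c ^ q * c⁻¹ ^ (q + 1) = c⁻¹ := by
    rw [Real.rpow_add hτ, Real.rpow_one, ← mul_assoc, ← Real.mul_rpow hc.le hτ.le,
      mul_inv_cancel₀ hc.ne', Real.one_rpow, one_mul]
  have hs : √(2 * Vmin) * √(2 * Vmin) = 2 * Vmin := Real.mul_self_sqrt (by positivity)
  have hs0 : √(2 * Vmin) ≠ 0 := by positivity
  have h2 : 2 - p.2 ≠ 0 := by linarith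
  calc _ = 4 * Vmin * (c ^ q * c⁻¹ ^ (q + 1)) / (q + 1) := by ring
    _ = 2 * (√(2 * Vmin) * √(2 * Vmin)) * c⁻¹ / (q + 1) := by rw [h1, hs]; ring
    _ = _ := by
      rw [hq2, hcdef, collisionRate]
      field_simp
      norm_num

end AnisotropicKepler

/-! ### Weak sequential compactness -/

/-- Sequential Banach-Alaoglu in the dual of a separable space, transported by the Riesz
isomorphism. -/
theorem exists_subseq_tendsto_inner {H : Type*} [NormedAddCommGroup H] [InnerProductSpace ℝ H]
    [CompleteSpace H] [TopologicalSpace.SeparableSpace H] {w : ℕ → H} {C : ℝ}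
    (hw : ∀ k, ‖w k‖ ≤ C) :
    ∃ (v : H) (φ : ℕ → ℕ), StrictMono φ ∧
      ∀ u : H, Tendsto (fun k => inner ℝ u (w (φ k))) atTop (𝓝 (inner ℝ u v)) := by
  obtain ⟨f, -, φ, hφ, hlim⟩ := WeakDual.isSeqCompact_closedBall ℝ H 0 C
    (x := fun k => StrongDual.toWeakDual (InnerProductSpace.toDual ℝ H (w k)))
    (fun k => by simpa using hw k)
  refine ⟨(InnerProductSpace.toDual ℝ H).symm (WeakDual.toStrongDual f), φ, hφ, fun u => ?_⟩
  have h := (WeakDual.eval_continuous u).continuousAt.tendsto.comp hlim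
  have h2 : inner ℝ u ((InnerProductSpace.toDual ℝ H).symm (WeakDual.toStrongDual f)) = f u := by
    rw [real_inner_comm, InnerProductSpace.toDual_symm_apply]; rfl
  rw [h2]
  refine h.congr fun k => ?_
  simp [real_inner_comm]

/-- Weak lower semicontinuity of the norm: testing against the limit itself gives `‖v‖² ≤ ‖v‖ κ`. -/
theorem norm_le_of_tendsto_inner {H : Type*} [NormedAddCommGroup H] [InnerProductSpace ℝ H]
    {w : ℕ → H} {v : H} {κ : ℝ} (hκ : Tendsto (fun k => ‖w k‖) atTop (𝓝 κ))
    (hv : Tendsto (fun k => inner ℝ v (w k)) atTop (𝓝 (inner ℝ v v))) : ‖v‖ ≤ κ := by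
  have h := le_of_tendsto_of_tendsto' hv (hκ.const_mul ‖v‖) fun k => real_inner_le_norm v (w k)
  rw [real_inner_self_eq_norm_mul_norm] at h
  rcases (norm_nonneg v).eq_or_lt with h0 | h0
  · rw [← h0]; exact ge_of_tendsto' hκ fun k => norm_nonneg _
  · exact le_of_mul_le_mul_left h h0

namespace AnisotropicKepler

variable {n : ℕ} {ξm ξp : UnitSphere n} {Vmin : ℝ} {p : (UnitSphere n → ℝ) × ℝ}
  {a b : ℝ} {x : ℝ → Space n}

theorem tendsto_of_tendsto_inner {u : ℕ → Space n} {v : Space n}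
    (h : ∀ c : Space n, Tendsto (fun k => inner ℝ c (u k)) atTop (𝓝 (inner ℝ c v))) :
    Tendsto u atTop (𝓝 v) := by
  let e := EuclideanSpace.basisFun (Fin (n + 1)) ℝ
  rw [← e.sum_repr' v]
  refine Tendsto.congr (fun k => e.sum_repr' (u k)) ?_
  exact tendsto_finsetSum _ fun i _ => (h (e i)).smul_const (e i)

theorem intervalIntegrable_of_memLp {v : ℝ → Space n} (hv : MemLp v 2 volume) (s t : ℝ) :
    IntervalIntegrable v volume s t :=
  ⟨(hv.restrict _).integrable one_le_two, (hv.restrict _).integrable one_le_two⟩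

theorem lintegral_half_sq_norm {v : ℝ → Space n} (hv : MemLp v 2 volume) :
    ∫⁻ t, ENNReal.ofReal (1 / 2 * ‖v t‖ ^ 2) = ENNReal.ofReal (1 / 2 * ‖hv.toLp v‖ ^ 2) := by
  have hI := (memLp_two_iff_integrable_sq_norm hv.1).1 hv
  rw [← ofReal_integral_eq_lintegral_ofReal (hI.const_mul _) (ae_of_all _ fun t => by positivity),
    integral_const_mul, ← real_inner_self_eq_norm_sq, L2.inner_def]
  congr 2
  refine integral_congr_ae ?_
  filter_upwards [hv.coeFn_toLp] with t ht
  rw [ht, real_inner_self_eq_norm_sq]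

/-- Pairing a primitive at time `t` with a vector `c` is an `L²` inner product with `c` times the
indicator of `(0, t]`. Weak convergence of velocities therefore gives pointwise convergence of
paths. -/
theorem tendsto_integral_of_tendsto_inner {w : ℕ → Lp (Space n) 2 (volume : Measure ℝ)}
    {v : Lp (Space n) 2 (volume : Measure ℝ)}
    (h : ∀ u, Tendsto (fun k => inner ℝ u (w k)) atTop (𝓝 (inner ℝ u v))) {t : ℝ} (ht : 0 ≤ t) :
    Tendsto (fun k => ∫ s in (0 : ℝ)..t, w k s) atTop (𝓝 (∫ s in (0 : ℝ)..t, v s)) := by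
  simp_rw [intervalIntegral.integral_of_le ht]
  refine tendsto_of_tendsto_inner fun c => ?_
  have hfin : volume (Ioc 0 t) ≠ ⊤ := by simp
  have := h (indicatorConstLp 2 measurableSet_Ioc hfin c)
  simpa only [L2.inner_indicatorConstLp_eq_inner_setIntegral] using this

/-! ### Velocities translated to the initial time `0` and extended by `0` -/

/-- The velocity of a path on `[a, b]`, translated to `[0, b - a]` and extended by `0`. -/
noncomputable def extendedVelocity (a b : ℝ) (x : ℝ → Space n) : ℝ → Space n :=
  (Ioo 0 (b - a)).indicator fun t => deriv x (a + t)

theorem preimage_add_Ioo (a b : ℝ) : (fun t => a + t) ⁻¹' Ioo a b = Ioo 0 (b - a) := by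
  rw [preimage_const_add_Ioo, sub_self]

theorem memLp_extendedVelocity (hx : IsH1 a b x) :
    MemLp (extendedVelocity a b x) 2 volume := by
  rw [extendedVelocity, memLp_indicator_iff_restrict measurableSet_Ioo]
  have h := (measurePreserving_add_left volume a).restrict_preimage
    (measurableSet_Ioo (a := a) (b := b))
  rw [preimage_add_Ioo] at h
  exact hx.2.comp_measurePreserving h

theorem integral_extendedVelocity (hx : IsH1 a b x) {t : ℝ} (ht : t ∈ Icc 0 (b - a)) :
    ∫ s in (0 : ℝ)..t, extendedVelocity a b x s = x (a + t) - x a := by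
  have h1 : ∫ s in (0 : ℝ)..t, extendedVelocity a b x s = ∫ s in (0 : ℝ)..t, deriv x (a + s) := by
    rw [intervalIntegral.integral_of_le ht.1, intervalIntegral.integral_of_le ht.1,
      ← restrict_Ioo_eq_restrict_Ioc]
    refine setIntegral_congr_fun measurableSet_Ioo fun s hs => ?_
    rw [extendedVelocity, indicator_of_mem (show s ∈ Ioo 0 (b - a) from ⟨hs.1, hs.2.trans_le ht.2⟩)]
  rw [h1, intervalIntegral.integral_comp_add_left (fun s => deriv x s) a, add_zero,
    hx.integral_deriv (t := a + t) ⟨by linarith [ht.1], by linarith [ht.2]⟩]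
  abel

/-- The rebuilt path rests at the endpoint after the final time; this lets the end condition survive
a limit in which the durations vary. -/
theorem integral_extendedVelocity_of_ge (hab : a ≤ b) (hx : IsH1 a b x) {t : ℝ}
    (ht : b - a ≤ t) : ∫ s in (0 : ℝ)..t, extendedVelocity a b x s = x b - x a := by
  have hI : ∀ s r, IntervalIntegrable (extendedVelocity a b x) volume s r := fun s r =>
    intervalIntegrable_of_memLp (memLp_extendedVelocity hx) s r
  rw [← intervalIntegral.integral_add_adjacent_intervals (hI 0 (b - a)) (hI (b - a) t),
    integral_extendedVelocity hx ⟨by linarith, le_rfl⟩]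
  have h0 : ∫ s in (b - a)..t, extendedVelocity a b x s = 0 := by
    rw [intervalIntegral.integral_of_le ht]
    refine setIntegral_eq_zero_of_forall_eq_zero fun s hs => ?_
    rw [extendedVelocity, indicator_of_notMem]
    exact fun h => absurd hs.1 (not_lt.2 h.2.le)
  rw [h0, add_zero]
  congr 2
  ring

/-- Paths on different intervals are compared in one Hilbert space `L²(ℝ)`: the kinetic part becomes
a squared norm there. -/
theorem action_eq_extendedVelocity (hx : IsH1 a b x) :
    action p a b x = ENNReal.ofReal (1 / 2 * ‖(memLp_extendedVelocity hx).toLp _‖ ^ 2) +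
      ∫⁻ t in Ioo 0 (b - a),
        singularPotential p (x a + ∫ s in (0 : ℝ)..t, extendedVelocity a b x s) := by
  have hmeas : Measurable fun t => ENNReal.ofReal (1 / 2 * ‖deriv x t‖ ^ 2) := by
    have := (measurable_deriv x).norm
    fun_prop
  have htr : ∀ f : ℝ → ℝ≥0∞, ∫⁻ t in Ioo a b, f t = ∫⁻ t in Ioo 0 (b - a), f (a + t) := fun f => by
    rw [← preimage_add_Ioo, (measurePreserving_add_left volume a).setLIntegral_comp_preimage_emb
      (measurableEmbedding_addLeft a)]
  rw [action, lintegral_add_left hmeas, htr, htr, ← lintegral_half_sq_norm]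
  congr 1
  · rw [← lintegral_indicator measurableSet_Ioo]
    refine lintegral_congr fun t => ?_
    by_cases ht : t ∈ Ioo 0 (b - a)
    · simp [extendedVelocity, ht]
    · simp [extendedVelocity, ht]
  · refine setLIntegral_congr_fun measurableSet_Ioo fun t ht => ?_
    rw [integral_extendedVelocity hx (Ioo_subset_Icc_self ht)]
    congr 1
    abel

end AnisotropicKepler

namespace AnisotropicKepler

variable {n : ℕ} {ξm ξp : UnitSphere n} {Vmin : ℝ} {p : (UnitSphere n → ℝ) × ℝ}
  {a b : ℝ} {x : ℝ → Space n}

/-! ### Existence of minimizers below the collision threshold -/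

theorem level_le_action (hx : IsAdmissible ξm ξp a b x) : level ξm ξp p ≤ action p a b x :=
  sInf_le ⟨a, b, x, hx, rfl⟩

/-- In the ball of radius `R` the potential is at least `Vmin/R^α`, so bounded action forces bounded
duration. -/
theorem ofReal_time_mul_le_action (hV : 0 < Vmin) (hmin : ∀ s, Vmin ≤ p.1 s) (hα0 : 0 < p.2)
    {R : ℝ} (hR : 0 < R) (hxR : ∀ t ∈ Icc a b, ‖x t‖ ≤ R) :
    ENNReal.ofReal ((b - a) * (Vmin / R ^ p.2)) ≤ action p a b x := by
  have h1 : ∀ t ∈ Ioo a b, ENNReal.ofReal (Vmin / R ^ p.2) ≤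
      ENNReal.ofReal (1 / 2 * ‖deriv x t‖ ^ 2) + singularPotential p (x t) := by
    intro t ht
    refine le_add_left ?_
    by_cases h0 : x t = 0
    · rw [h0, singularPotential_zero]; exact le_top
    rw [singularPotential_of_ne h0]
    refine ENNReal.ofReal_le_ofReal (le_trans ?_ (le_potential hmin h0))
    have hpos : 0 < ‖x t‖ := norm_pos_iff.2 h0
    have := hxR t (Ioo_subset_Icc_self ht)
    gcongr
  calc _ = ∫⁻ _ in Ioo a b, ENNReal.ofReal (Vmin / R ^ p.2) := by
        rw [setLIntegral_const, Real.volume_Ioo, mul_comm, ENNReal.ofReal_mul (by positivity)]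
    _ ≤ _ := setLIntegral_mono' measurableSet_Ioo h1

theorem exists_minimizing_sequence {A : ℝ≥0∞} (hA : level ξm ξp p < A) :
    ∃ (a b : ℕ → ℝ) (x : ℕ → ℝ → Space n),
      (∀ k, IsAdmissible ξm ξp (a k) (b k) (x k)) ∧ (∀ k, action p (a k) (b k) (x k) ≤ A) ∧
      Tendsto (fun k => action p (a k) (b k) (x k)) atTop (𝓝 (level ξm ξp p)) := by
  have hne : {A | ∃ (a b : ℝ) (x : ℝ → Space n),
      IsAdmissible ξm ξp a b x ∧ A = action p a b x}.Nonempty := by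
    obtain ⟨B, hB, -⟩ := sInf_lt_iff.1 hA
    exact ⟨B, hB⟩
  obtain ⟨u, -, hu, hmem⟩ := exists_seq_tendsto_sInf hne (OrderBot.bddBelow _)
  obtain ⟨N, hN⟩ := eventually_atTop.1 (hu.eventually_lt_const hA)
  choose a b x hx hact using hmem
  refine ⟨fun k => a (k + N), fun k => b (k + N), fun k => x (k + N), fun k => hx _, fun k => ?_, ?_⟩
  · rw [← hact]; exact (hN _ (by lia)).le
  · refine (hu.comp (tendsto_add_atTop_nat N)).congr fun k => ?_
    exact hact (k + N)

theorem tendsto_singularPotential (hp : ContMDiff (𝓡 n) 𝓘(ℝ, ℝ) 2 p.1) {u : ℕ → Space n}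
    {v : Space n} (h : Tendsto u atTop (𝓝 v)) (hv : v ≠ 0) :
    Tendsto (fun k => singularPotential p (u k)) atTop (𝓝 (singularPotential p v)) := by
  rw [singularPotential_of_ne hv]
  have hc := ENNReal.continuous_ofReal.continuousAt.tendsto.comp
    ((contDiffAt_potential hp hv).continuousAt.tendsto.comp h)
  refine hc.congr' ?_
  filter_upwards [h.eventually (isOpen_compl_singleton.mem_nhds hv)] with k hk
  rw [singularPotential_of_ne hk]
  rfl

/-- Fatou's lemma with the moving intervals encoded by indicators: each `t < T'` eventually lies in
`(0, T k)`, and the potential is continuous at the limit point, which is not the origin. -/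
theorem lintegral_singularPotential_le_liminf (hp : ContMDiff (𝓡 n) 𝓘(ℝ, ℝ) 2 p.1)
    {z : ℕ → ℝ → Space n} {ζ : ℝ → Space n} {T : ℕ → ℝ} {T' : ℝ}
    (hz : ∀ k, Continuous (z k)) (hT : Tendsto T atTop (𝓝 T'))
    (hlim : ∀ t ∈ Ioo 0 T', Tendsto (fun k => z k t) atTop (𝓝 (ζ t)))
    (hne : ∀ t ∈ Ioo 0 T', ζ t ≠ 0) :
    ∫⁻ t in Ioo 0 T', singularPotential p (ζ t) ≤
      liminf (fun k => ∫⁻ t in Ioo 0 (T k), singularPotential p (z k t)) atTop := by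
  have hmeas : ∀ k, Measurable ((Ioo 0 (T k)).indicator fun t => singularPotential p (z k t)) :=
    fun k => ((measurable_singularPotential hp).comp (hz k).measurable).indicator measurableSet_Ioo
  have hfatou := lintegral_liminf_le (μ := volume) (u := atTop) hmeas
  simp_rw [lintegral_indicator measurableSet_Ioo] at hfatou
  refine le_trans ?_ hfatou
  rw [← lintegral_indicator measurableSet_Ioo]
  refine lintegral_mono fun t => ?_
  by_cases ht : t ∈ Ioo 0 T'
  · rw [indicator_of_mem ht]
    refine (Tendsto.liminf_eq ?_).ge
    refine (tendsto_singularPotential hp (hlim t ht) (hne t ht)).congr' ?_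
    filter_upwards [hT.eventually_const_lt ht.2] with k hk
    rw [indicator_of_mem (show t ∈ Ioo 0 (T k) from ⟨ht.1, hk⟩)]
  · rw [indicator_of_notMem ht]; exact zero_le

/-- Direct method. The velocities of a minimizing sequence, restarted at time `0`, converge weakly
in `L²`; the norm is weakly lower semicontinuous and the potential term is handled by Fatou. -/
theorem exists_achieves_of_level_lt (hp : ContMDiff (𝓡 n) 𝓘(ℝ, ℝ) 2 p.1) (hξ : ξp ≠ ξm)
    (hV : 0 < Vmin) (hmin : ∀ s, Vmin ≤ p.1 s) (hα0 : 0 < p.2) (hα : p.2 < 2)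
    (hlev : level ξm ξp p < ENNReal.ofReal (4 * √(2 * Vmin) / (2 - p.2))) :
    ∃ (a b : ℝ) (x : ℝ → Space n), Achieves ξm ξp p a b x := by
  obtain ⟨A, hA, hA'⟩ := exists_between hlev
  have hAtop : A ≠ ⊤ := ne_top_of_lt hA'
  obtain ⟨a, b, x, hadm, hact, hlim⟩ := exists_minimizing_sequence hA
  obtain ⟨ρ, R, hρ, hR, hann⟩ := exists_annulus (p := p) hV hmin hα0 hα hA'
  have hH1 : ∀ k, IsH1 (a k) (b k) (x k) := fun k => (hadm k).isH1
  let w : ℕ → ℝ → Space n := fun k => extendedVelocity (a k) (b k) (x k)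
  let W : ℕ → Lp (Space n) 2 (volume : Measure ℝ) := fun k => (memLp_extendedVelocity (hH1 k)).toLp _
  let z : ℕ → ℝ → Space n := fun k t => (ξm : Space n) + ∫ s in (0 : ℝ)..t, w k s
  let P : ℕ → ℝ≥0∞ := fun k => ∫⁻ t in Ioo 0 (b k - a k), singularPotential p (z k t)
  have hsplit : ∀ k, action p (a k) (b k) (x k) = ENNReal.ofReal (1 / 2 * ‖W k‖ ^ 2) + P k := by
    intro k
    rw [action_eq_extendedVelocity (hH1 k), (hadm k).left]
  have hz : ∀ k, Continuous (z k) := fun k => continuous_const.add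
    (intervalIntegral.continuous_primitive
      (intervalIntegrable_of_memLp (memLp_extendedVelocity (hH1 k))) 0)
  have hzx : ∀ k, ∀ t ∈ Icc 0 (b k - a k), z k t = x k (a k + t) := fun k t ht => by
    simp only [z, w, integral_extendedVelocity (hH1 k) ht, (hadm k).left]
    abel
  have hzend : ∀ k, ∀ t, b k - a k ≤ t → z k t = ξp := fun k t ht => by
    simp only [z, w, integral_extendedVelocity_of_ge (hadm k).lt.le (hH1 k) ht, (hadm k).left,
      (hadm k).right]
    abel
  have hT : ∀ k, b k - a k ∈ Icc 0 (A.toReal / (Vmin / R ^ p.2)) := fun k => by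
    refine ⟨sub_nonneg.2 (hadm k).lt.le, ?_⟩
    have h := (ofReal_time_mul_le_action hV hmin hα0 hR
      (fun t ht => (hann _ _ _ _ _ (hadm k) (hact k) t ht).2)).trans (hact k)
    rw [le_div_iff₀ (by positivity)]
    exact (ENNReal.ofReal_le_iff_le_toReal hAtop).1 h
  have hW : ∀ k, ‖W k‖ ≤ √(2 * A.toReal) := fun k => by
    have h : ENNReal.ofReal (1 / 2 * ‖W k‖ ^ 2) ≤ A :=
      le_self_add.trans ((hsplit k).symm.le.trans (hact k))
    have h2 := (ENNReal.ofReal_le_iff_le_toReal hAtop).1 h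
    exact Real.le_sqrt_of_sq_le (by linarith)
  have : Fact ((2 : ℝ≥0∞) ≠ ⊤) := ⟨ENNReal.ofNat_ne_top⟩
  have : SecondCountableTopology (Lp (Space n) 2 (volume : Measure ℝ)) :=
    Lp.SecondCountableTopology
  obtain ⟨v, φ, hφ, hweak⟩ := exists_subseq_tendsto_inner hW
  -- A further subsequence makes the durations and the kinetic norms converge. With the kinetic
  -- limit known, the potential terms converge too, and the two parts can be treated separately.
  obtain ⟨⟨T, κ⟩, hTκ, ψ, hψ, hTκlim⟩ := (isCompact_Icc.prod isCompact_Icc).tendsto_subseq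
    (x := fun k => (b (φ k) - a (φ k), ‖W (φ k)‖))
    (fun k => mk_mem_prod (hT _) ⟨norm_nonneg _, hW _⟩)
  have hTlim : Tendsto (fun k => b (φ (ψ k)) - a (φ (ψ k))) atTop (𝓝 T) :=
    (continuous_fst.tendsto _).comp hTκlim
  have hκlim : Tendsto (fun k => ‖W (φ (ψ k))‖) atTop (𝓝 κ) :=
    (continuous_snd.tendsto _).comp hTκlim
  have hT0 : 0 ≤ T := (hTκ.1).1
  have hweak' : ∀ u, Tendsto (fun k => inner ℝ u (W (φ (ψ k)))) atTop (𝓝 (inner ℝ u v)) :=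
    fun u => (hweak u).comp hψ.tendsto_atTop
  have hvκ : ‖v‖ ≤ κ := norm_le_of_tendsto_inner hκlim (hweak' v)
  have hvL : MemLp v 2 volume := Lp.memLp v
  let ζ : ℝ → Space n := fun t => (ξm : Space n) + ∫ s in (0 : ℝ)..t, v s
  have hζ : Continuous ζ := continuous_const.add
    (intervalIntegral.continuous_primitive (intervalIntegrable_of_memLp hvL) 0)
  have hzζ : ∀ t, 0 ≤ t → Tendsto (fun k => z (φ (ψ k)) t) atTop (𝓝 (ζ t)) := fun t ht => by
    refine Tendsto.const_add _ ((tendsto_integral_of_tendsto_inner hweak' ht).congr fun k => ?_)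
    refine intervalIntegral.integral_congr_ae ?_
    filter_upwards [(memLp_extendedVelocity (hH1 (φ (ψ k)))).coeFn_toLp] with s hs _
    exact hs
  -- The approximating durations need not be below `T`, so the end value is found at times `t > T`,
  -- where the approximating paths eventually rest at `ξp`, and brought back to `T` by continuity.
  have hζend : ζ T = ξp := by
    have hgt : ∀ t, T < t → ζ t = ξp := fun t ht => by
      refine tendsto_nhds_unique (hzζ t (hT0.trans ht.le)) (tendsto_const_nhds.congr' ?_)
      filter_upwards [hTlim.eventually_lt_const ht] with k hk
      exact (hzend _ t hk.le).symm
    have h1 : Tendsto ζ (𝓝[>] T) (𝓝 (ζ T)) := (hζ.tendsto T).mono_left nhdsWithin_le_nhds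
    refine tendsto_nhds_unique h1 (tendsto_const_nhds.congr' ?_)
    filter_upwards [self_mem_nhdsWithin] with t ht using (hgt t ht).symm
  have hζ0 : ζ 0 = ξm := by simp [ζ]
  -- A zero limiting duration would make the two endpoints equal.
  have hTpos : 0 < T := by
    refine hT0.lt_of_ne fun h => hξ ?_
    rw [← h, hζ0] at hζend
    exact Subtype.ext hζend.symm
  have hζint : ∀ t ∈ Icc 0 T, ζ t = ζ 0 + ∫ s in (0 : ℝ)..t, v s := fun t _ => by rw [hζ0]
  have hadmζ : IsAdmissible ξm ξp 0 T ζ :=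
    ⟨hTpos, isH1_of_eq_integral hT0 (hvL.restrict _) hζint, hζ0, hζend⟩
  refine ⟨0, T, ζ, hadmζ, le_antisymm ?_ (level_le_action hadmζ)⟩
  have hζne : ∀ t ∈ Ioo 0 T, ζ t ≠ 0 := fun t ht => by
    rw [← norm_pos_iff]
    refine hρ.trans_le (ge_of_tendsto (hzζ t ht.1.le).norm ?_)
    filter_upwards [hTlim.eventually_const_lt ht.2] with k hk
    rw [hzx _ t ⟨ht.1.le, hk.le⟩]
    exact (hann _ _ _ _ _ (hadm _) (hact _) _ ⟨by linarith [ht.1], by linarith⟩).1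
  have hpot := lintegral_singularPotential_le_liminf hp (fun k => hz (φ (ψ k))) hTlim
    (fun t ht => hzζ t ht.1.le) hζne
  have hkinlim : Tendsto (fun k => ENNReal.ofReal (1 / 2 * ‖W (φ (ψ k))‖ ^ 2)) atTop
      (𝓝 (ENNReal.ofReal (1 / 2 * κ ^ 2))) :=
    (ENNReal.continuous_ofReal.tendsto _).comp ((hκlim.pow 2).const_mul _)
  have hactlim := hlim.comp (hφ.comp hψ).tendsto_atTop
  have hκlev : ENNReal.ofReal (1 / 2 * κ ^ 2) ≤ level ξm ξp p :=
    le_of_tendsto_of_tendsto' hkinlim hactlim fun k => by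
      simp only [Function.comp, hsplit]; exact le_self_add
  have hPlim : Tendsto (fun k => P (φ (ψ k))) atTop
      (𝓝 (level ξm ξp p - ENNReal.ofReal (1 / 2 * κ ^ 2))) := by
    refine (ENNReal.Tendsto.sub hactlim hkinlim (Or.inr ENNReal.ofReal_ne_top)).congr fun k => ?_
    simp only [Function.comp, hsplit]
    exact ENNReal.add_sub_cancel_left ENNReal.ofReal_ne_top
  have hkin : ∫⁻ t in Ioo 0 T, ENNReal.ofReal (1 / 2 * ‖deriv ζ t‖ ^ 2) ≤
      ENNReal.ofReal (1 / 2 * κ ^ 2) := by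
    calc _ = ∫⁻ t in Ioo 0 T, ENNReal.ofReal (1 / 2 * ‖v t‖ ^ 2) := by
          refine lintegral_congr_ae ?_
          filter_upwards [ae_deriv_of_eq_integral hT0 (hvL.restrict _) hζint] with t ht
          rw [ht.deriv]
      _ ≤ ∫⁻ t, ENNReal.ofReal (1 / 2 * ‖v t‖ ^ 2) := setLIntegral_le_lintegral _ _
      _ = ENNReal.ofReal (1 / 2 * ‖v‖ ^ 2) := by rw [lintegral_half_sq_norm hvL, Lp.toLp_coeFn]
      _ ≤ _ := by gcongr
  have hmeas : Measurable fun t => ENNReal.ofReal (1 / 2 * ‖deriv ζ t‖ ^ 2) := by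
    have := (measurable_deriv ζ).norm
    fun_prop
  rw [action, lintegral_add_left hmeas]
  calc _ ≤ ENNReal.ofReal (1 / 2 * κ ^ 2) + (level ξm ξp p - ENNReal.ofReal (1 / 2 * κ ^ 2)) :=
        add_le_add hkin (hpot.trans_eq hPlim.liminf_eq)
    _ = _ := add_tsub_cancel_of_le hκlev

end AnisotropicKepler

namespace AnisotropicKepler

variable {n : ℕ} {ξm ξp : UnitSphere n} {Vmin : ℝ} {p : (UnitSphere n → ℝ) × ℝ}
  {a b : ℝ} {x : ℝ → Space n}

/-! ### The Euler-Lagrange equation -/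

theorem integrableOn_potential_comp (hp : ContMDiff (𝓡 n) 𝓘(ℝ, ℝ) 2 p.1)
    (hx : ContinuousOn x (Icc a b)) (hne : ∀ t ∈ Icc a b, x t ≠ 0) :
    IntegrableOn (fun t => potential p (x t)) (Ioo a b) :=
  (ContinuousOn.integrableOn_Icc ((continuousOn_potential hp).comp hx hne)).mono_set
    Ioo_subset_Icc_self

theorem action_eq_ofReal (hp : ContMDiff (𝓡 n) 𝓘(ℝ, ℝ) 2 p.1) (hV : 0 ≤ Vmin)
    (hmin : ∀ s, Vmin ≤ p.1 s) (hx : ContinuousOn x (Icc a b)) (hne : ∀ t ∈ Icc a b, x t ≠ 0)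
    {v : ℝ → Space n} (hv : MemLp v 2 (volume.restrict (Ioo a b)))
    (hxv : ∀ᵐ t ∂volume.restrict (Ioo a b), HasDerivAt x (v t) t) :
    action p a b x = ENNReal.ofReal
      ((∫ t in Ioo a b, 1 / 2 * ‖v t‖ ^ 2) + ∫ t in Ioo a b, potential p (x t)) := by
  have hpot : ∀ t ∈ Icc a b, 0 ≤ potential p (x t) := fun t ht =>
    (by positivity : 0 ≤ Vmin / ‖x t‖ ^ p.2).trans (le_potential hmin (hne t ht))
  have hK : Integrable (fun t => 1 / 2 * ‖v t‖ ^ 2) (volume.restrict (Ioo a b)) :=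
    ((memLp_two_iff_integrable_sq_norm hv.1).1 hv).const_mul _
  have hP := integrableOn_potential_comp hp hx hne
  have hKP : Integrable (fun t => 1 / 2 * ‖v t‖ ^ 2 + potential p (x t))
      (volume.restrict (Ioo a b)) := hK.add hP
  rw [← integral_add hK hP, ofReal_integral_eq_lintegral_ofReal hKP, action]
  · refine lintegral_congr_ae ?_
    filter_upwards [hxv, ae_restrict_mem measurableSet_Ioo] with t ht hmem
    have hmem' := Ioo_subset_Icc_self hmem
    rw [ht.deriv, singularPotential_of_ne (hne t hmem'),
      ← ENNReal.ofReal_add (by positivity) (hpot t hmem')]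
  · filter_upwards [ae_restrict_mem measurableSet_Ioo] with t hmem
    exact add_nonneg (by positivity) (hpot t (Ioo_subset_Icc_self hmem))

theorem exists_gradient_bound (hp : ContMDiff (𝓡 n) 𝓘(ℝ, ℝ) 2 p.1) {r R : ℝ} (hr : 0 < r) :
    ∃ C, ∀ y : Space n, r ≤ ‖y‖ → ‖y‖ ≤ R → ‖gradient (potential p) y‖ ≤ C := by
  have hK : IsCompact {y : Space n | r ≤ ‖y‖ ∧ ‖y‖ ≤ R} := by
    have : {y : Space n | r ≤ ‖y‖ ∧ ‖y‖ ≤ R} = Metric.closedBall 0 R ∩ {y | r ≤ ‖y‖} := by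
      ext y; simp [and_comm]
    rw [this]
    exact (isCompact_closedBall 0 R).inter_right (isClosed_le continuous_const continuous_norm)
  obtain ⟨C, hC⟩ := hK.exists_bound_of_continuousOn (f := gradient (potential p)) fun y hy =>
    (continuousAt_gradient_potential hp (norm_pos_iff.1 (hr.trans_le hy.1))).continuousWithinAt
  exact ⟨C, fun y h1 h2 => hC y ⟨h1, h2⟩⟩

/-- The bound on `ε` keeps the perturbation below half the distance to the origin; the `+ 1` keeps
the denominator positive when `Φ = 0`. -/
theorem norm_add_smul_ge {y z : Space n} {ρ Φ ε : ℝ} (hΦ : ‖z‖ ≤ Φ) (hy : ρ ≤ ‖y‖)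
    (hΦ0 : 0 ≤ Φ) (hε : |ε| < ρ / (2 * (Φ + 1))) : ρ / 2 ≤ ‖y + ε • z‖ := by
  have h1 : ‖ε • z‖ ≤ ρ / 2 := by
    rw [norm_smul, Real.norm_eq_abs]
    rw [lt_div_iff₀ (by positivity)] at hε
    have : |ε| * ‖z‖ ≤ |ε| * Φ := by gcongr
    nlinarith [abs_nonneg ε]
  have h2 := norm_sub_norm_le y (-(ε • z))
  rw [sub_neg_eq_add, norm_neg] at h2
  linarith

/-- Differentiation under the integral sign: for small `ε` the perturbed path stays in a compact
annulus avoiding the origin, where the gradient is bounded, and this gives a constant dominating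
function. -/
theorem hasDerivAt_integral_potential (hp : ContMDiff (𝓡 n) 𝓘(ℝ, ℝ) 2 p.1)
    {φ : ℝ → Space n} (hx : ContinuousOn x (Icc a b)) (hφ : ContinuousOn φ (Icc a b)) {ρ R Φ : ℝ}
    (hρ : 0 < ρ) (hρx : ∀ t ∈ Icc a b, ρ ≤ ‖x t‖) (hxR : ∀ t ∈ Icc a b, ‖x t‖ ≤ R)
    (hΦ0 : 0 ≤ Φ) (hΦ : ∀ t ∈ Icc a b, ‖φ t‖ ≤ Φ) :
    HasDerivAt (fun ε : ℝ => ∫ t in Ioo a b, potential p (x t + ε • φ t))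
      (∫ t in Ioo a b, inner ℝ (gradient (potential p) (x t)) (φ t)) 0 := by
  set ε₀ := ρ / (2 * (Φ + 1)) with hε₀
  have hε₀pos : 0 < ε₀ := by positivity
  have hlow : ∀ ε ∈ Metric.ball (0 : ℝ) ε₀, ∀ t ∈ Icc a b, ρ / 2 ≤ ‖x t + ε • φ t‖ :=
    fun ε hε t ht => norm_add_smul_ge (hΦ t ht) (hρx t ht) hΦ0 (by simpa using hε)
  have hne : ∀ ε ∈ Metric.ball (0 : ℝ) ε₀, ∀ t ∈ Icc a b, x t + ε • φ t ≠ 0 :=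
    fun ε hε t ht => norm_pos_iff.1 ((half_pos hρ).trans_le (hlow ε hε t ht))
  have hcont : ∀ ε : ℝ, ContinuousOn (fun t => x t + ε • φ t) (Icc a b) := fun ε =>
    hx.add (hφ.const_smul ε)
  have hgrad : ContinuousOn (fun t => gradient (potential p) (x t)) (Icc a b) := fun t ht =>
    (continuousAt_gradient_potential hp (norm_pos_iff.1 (hρ.trans_le
      (hρx t ht)))).comp_continuousWithinAt (hx t ht)
  obtain ⟨C, hC⟩ := exists_gradient_bound (p := p) hp (R := R + ε₀ * Φ) (half_pos hρ)
  have h0 : (0 : ℝ) ∈ Metric.ball (0 : ℝ) ε₀ := Metric.mem_ball_self hε₀pos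
  have key := (hasDerivAt_integral_of_dominated_loc_of_deriv_le (μ := volume.restrict (Ioo a b))
    (F := fun (ε : ℝ) t => potential p (x t + ε • φ t))
    (F' := fun (ε : ℝ) t => inner ℝ (gradient (potential p) (x t + ε • φ t)) (φ t))
    (x₀ := 0) (s := Metric.ball 0 ε₀) (bound := fun _ => C * Φ) (Metric.ball_mem_nhds 0 hε₀pos)
    ?_ ?_ ?_ ?_ ?_ ?_).2
  · simpa using key
  · filter_upwards [Metric.ball_mem_nhds (0 : ℝ) hε₀pos] with ε hε
    exact (integrableOn_potential_comp hp (hcont ε) (hne ε hε)).1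
  · exact integrableOn_potential_comp hp (hcont 0) (hne 0 h0)
  · simp only [zero_smul, add_zero]
    exact ((hgrad.inner hφ).mono Ioo_subset_Icc_self).aestronglyMeasurable measurableSet_Ioo
  · filter_upwards [ae_restrict_mem measurableSet_Ioo] with t ht ε hε
    have ht' := Ioo_subset_Icc_self ht
    have hε' : |ε| ≤ ε₀ := by simpa using (Metric.mem_ball.1 hε).le
    have hup : ‖x t + ε • φ t‖ ≤ R + ε₀ * Φ := by
      refine (norm_add_le _ _).trans (add_le_add (hxR t ht') ?_)
      rw [norm_smul, Real.norm_eq_abs]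
      exact mul_le_mul hε' (hΦ t ht') (norm_nonneg _) hε₀pos.le
    have hCb := hC _ (hlow ε hε t ht') hup
    refine (norm_inner_le_norm _ _).trans ?_
    exact mul_le_mul hCb (hΦ t ht') (norm_nonneg _) ((norm_nonneg _).trans hCb)
  · exact integrable_const _
  · filter_upwards [ae_restrict_mem measurableSet_Ioo] with t ht ε hε
    have hg := (differentiableAt_potential hp
      (hne ε hε t (Ioo_subset_Icc_self ht))).hasGradientAt.hasFDerivAt
    have hl : HasDerivAt (fun ε : ℝ => x t + ε • φ t) (φ t) ε := by
      simpa using ((hasDerivAt_id ε).smul_const (φ t)).const_add (x t)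
    exact hg.comp_hasDerivAt ε hl

theorem integrable_inner_of_memLp {μ : Measure ℝ} {v w : ℝ → Space n} (hv : MemLp v 2 μ)
    (hw : MemLp w 2 μ) : Integrable (fun t => inner ℝ (v t) (w t)) μ := by
  have h := L2.integrable_inner (𝕜 := ℝ) (hv.toLp v) (hw.toLp w)
  refine h.congr ?_
  filter_upwards [hv.coeFn_toLp, hw.coeFn_toLp] with t h1 h2
  rw [h1, h2]

theorem integral_half_sq_norm_add_smul {μ : Measure ℝ} {v w : ℝ → Space n} (hv : MemLp v 2 μ)
    (hw : MemLp w 2 μ) (ε : ℝ) :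
    ∫ t, 1 / 2 * ‖v t + ε • w t‖ ^ 2 ∂μ = (∫ t, 1 / 2 * ‖v t‖ ^ 2 ∂μ) +
      ε * (∫ t, inner ℝ (v t) (w t) ∂μ) + ε ^ 2 * ∫ t, 1 / 2 * ‖w t‖ ^ 2 ∂μ := by
  have hv2 : Integrable (fun t => 1 / 2 * ‖v t‖ ^ 2) μ :=
    ((memLp_two_iff_integrable_sq_norm hv.1).1 hv).const_mul _
  have hw2 : Integrable (fun t => 1 / 2 * ‖w t‖ ^ 2) μ :=
    ((memLp_two_iff_integrable_sq_norm hw.1).1 hw).const_mul _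
  have hvw := integrable_inner_of_memLp hv hw
  have hvvw : Integrable (fun t => 1 / 2 * ‖v t‖ ^ 2 + ε * inner ℝ (v t) (w t)) μ :=
    hv2.add (hvw.const_mul ε)
  rw [← integral_const_mul, ← integral_const_mul, ← integral_add hv2 (hvw.const_mul ε),
    ← integral_add hvvw (hw2.const_mul _)]
  refine integral_congr_ae (ae_of_all _ fun t => ?_)
  simp only [norm_add_sq_real, norm_smul, inner_smul_right, mul_pow, Real.norm_eq_abs, sq_abs]
  ring

theorem hasDerivAt_quadratic (A B C : ℝ) :
    HasDerivAt (fun ε : ℝ => A + ε * B + ε ^ 2 * C) B 0 := by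
  have h := (((hasDerivAt_id (0 : ℝ)).mul_const B).const_add A).add
    ((hasDerivAt_pow 2 (0 : ℝ)).mul_const C)
  exact h.congr_deriv (by simp)

/-- The first variation of the action vanishes along a collisionless minimizer. -/
theorem Achieves.first_variation (hp : ContMDiff (𝓡 n) 𝓘(ℝ, ℝ) 2 p.1) (hV : 0 ≤ Vmin)
    (hmin : ∀ s, Vmin ≤ p.1 s) (hx : Achieves ξm ξp p a b x) {ρ : ℝ} (hρ : 0 < ρ)
    (hρx : ∀ t ∈ Icc a b, ρ ≤ ‖x t‖) {w : ℝ → Space n}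
    (hw : MemLp w 2 (volume.restrict (Ioo a b))) (hw0 : ∫ t in a..b, w t = 0) :
    (∫ t in Ioo a b, inner ℝ (deriv x t) (w t)) +
      ∫ t in Ioo a b, inner ℝ (gradient (potential p) (x t)) (∫ s in a..t, w s) = 0 := by
  obtain ⟨hadm, hact⟩ := hx
  have hab := hadm.lt.le
  have hxc := hadm.isH1.continuousOn hab
  have hwI := intervalIntegrable_of_memLp_Ioo hw hab
  have hxI := hadm.isH1.intervalIntegrable_deriv hab
  -- The variation is prescribed by its velocity `w`; the zero mean of `w` makes it vanish at both
  -- ends.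
  set φ : ℝ → Space n := fun t => ∫ s in a..t, w s with hφdef
  have hφc : ContinuousOn φ (Icc a b) := by
    have := hwI.absolutelyContinuousOnInterval_integral_normed.continuousOn
    rwa [uIcc_of_le hab] at this
  obtain ⟨R, hR⟩ := isCompact_Icc.exists_bound_of_continuousOn hxc
  obtain ⟨Φ', hΦ'⟩ := isCompact_Icc.exists_bound_of_continuousOn hφc
  set Φ := max Φ' 0
  have hΦ0 : 0 ≤ Φ := le_max_right _ _
  have hΦ : ∀ t ∈ Icc a b, ‖φ t‖ ≤ Φ := fun t ht => (hΦ' t ht).trans (le_max_left _ _)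
  have hε₀pos : 0 < ρ / (2 * (Φ + 1)) := by positivity
  let J : ℝ → ℝ := fun ε => (∫ t in Ioo a b, 1 / 2 * ‖deriv x t + ε • w t‖ ^ 2) +
    ∫ t in Ioo a b, potential p (x t + ε • φ t)
  have hJ : HasDerivAt J ((∫ t in Ioo a b, inner ℝ (deriv x t) (w t)) +
      ∫ t in Ioo a b, inner ℝ (gradient (potential p) (x t)) (φ t)) 0 := by
    refine HasDerivAt.add ?_ (hasDerivAt_integral_potential hp hxc hφc hρ hρx hR hΦ0 hΦ)
    simp_rw [integral_half_sq_norm_add_smul hadm.isH1.2 hw]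
    exact hasDerivAt_quadratic _ _ _
  have hJact : ∀ ε : ℝ, |ε| < ρ / (2 * (Φ + 1)) →
      IsAdmissible ξm ξp a b (fun t => x t + ε • φ t) ∧
      action p a b (fun t => x t + ε • φ t) = ENNReal.ofReal (J ε) := by
    intro ε hε
    have hv : MemLp (fun t => deriv x t + ε • w t) 2 (volume.restrict (Ioo a b)) :=
      hadm.isH1.2.add (hw.const_smul ε)
    have hφa : φ a = 0 := by simp [hφdef]
    have hyint : ∀ t ∈ Icc a b, x t + ε • φ t =
        (x a + ε • φ a) + ∫ s in a..t, (deriv x s + ε • w s) := fun t ht => by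
      have hsub : uIcc a t ⊆ uIcc a b := by
        rw [uIcc_of_le ht.1, uIcc_of_le hab]; exact Icc_subset_Icc le_rfl ht.2
      have hεw : IntervalIntegrable (fun s => ε • w s) volume a t := (hwI.mono_set hsub).smul ε
      rw [intervalIntegral.integral_add (hxI.mono_set hsub) hεw,
        intervalIntegral.integral_smul, hadm.isH1.integral_deriv ht, hφa, smul_zero, add_zero,
        add_assoc]
    refine ⟨⟨hadm.lt, isH1_of_eq_integral hab hv hyint, ?_, ?_⟩, ?_⟩
    · simp [hφa, hadm.left]
    · simp [hφdef, hw0, hadm.right]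
    · exact action_eq_ofReal hp hV hmin (hxc.add (hφc.const_smul ε))
        (fun t ht => norm_pos_iff.1 ((half_pos hρ).trans_le
          (norm_add_smul_ge (hΦ t ht) (hρx t ht) hΦ0 hε)))
        hv (ae_deriv_of_eq_integral hab hv hyint)
  -- Since `ENNReal.ofReal` truncates negative numbers, comparing actions yields a comparison of
  -- values of `J` only once these are known to be nonnegative.
  have hJnonneg : ∀ ε : ℝ, |ε| < ρ / (2 * (Φ + 1)) → 0 ≤ J ε := fun ε hε => by
    refine add_nonneg (integral_nonneg fun t => by positivity)
      (setIntegral_nonneg measurableSet_Ioo fun t ht => ?_)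
    refine (by positivity : 0 ≤ Vmin / ‖x t + ε • φ t‖ ^ p.2).trans
      (le_potential hmin (norm_pos_iff.1 ((half_pos hρ).trans_le ?_)))
    have ht' := Ioo_subset_Icc_self ht
    exact norm_add_smul_ge (hΦ t ht') (hρx t ht') hΦ0 hε
  have hloc : IsLocalMin J 0 := by
    filter_upwards [Metric.ball_mem_nhds (0 : ℝ) hε₀pos] with ε hε
    have hε' : |ε| < ρ / (2 * (Φ + 1)) := by simpa using hε
    obtain ⟨h1, h2⟩ := hJact ε hε'
    obtain ⟨-, h4⟩ := hJact 0 (by simpa using hε₀pos)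
    simp only [zero_smul, add_zero] at h4
    have h5 : ENNReal.ofReal (J 0) ≤ ENNReal.ofReal (J ε) := by
      rw [← h2, ← h4, hact]
      exact level_le_action h1
    exact (ENNReal.ofReal_le_ofReal_iff (hJnonneg ε hε')).1 h5
  exact hloc.hasDerivAt_eq_zero hJ

/-- Integration by parts; the boundary terms vanish because the primitive of `w` is zero at both
ends. -/
theorem integral_inner_primitive_eq_neg {g w : ℝ → Space n} (hab : a ≤ b)
    (hg : IntervalIntegrable g volume a b) (hw : IntervalIntegrable w volume a b)
    (hw0 : ∫ t in a..b, w t = 0) :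
    (∫ t in Ioo a b, inner ℝ (g t) (∫ s in a..t, w s)) =
      -∫ t in Ioo a b, inner ℝ (∫ s in a..t, g s) (w t) := by
  set G : ℝ → Space n := fun t => ∫ s in a..t, g s with hG
  set φ : ℝ → Space n := fun t => ∫ s in a..t, w s with hφ
  have hGac := hg.absolutelyContinuousOnInterval_integral_normed
  have hφac := hw.absolutelyContinuousOnInterval_integral_normed
  have hGc : ContinuousOn G (uIcc a b) := hGac.continuousOn
  have hφc : ContinuousOn φ (uIcc a b) := hφac.continuousOn
  -- Polarization writes the inner product through products of norms, which are scalar absolutely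
  -- continuous functions.
  have hac : AbsolutelyContinuousOnInterval (fun t => inner ℝ (G t) (φ t)) a b := by
    have h1 := lipschitzWith_one_norm.comp_absolutelyContinuousOnInterval hGac
    have h2 := lipschitzWith_one_norm.comp_absolutelyContinuousOnInterval hφac
    have h3 := lipschitzWith_one_norm.comp_absolutelyContinuousOnInterval (hGac.fun_sub hφac)
    have h4 := (((h1.fun_mul h1).fun_add (h2.fun_mul h2)).fun_sub (h3.fun_mul h3)).const_mul (1 / 2)
    convert h4 using 2 with t
    rw [real_inner_eq_norm_mul_self_add_norm_mul_self_sub_norm_sub_mul_self_div_two]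
    ring
  have h0 := hac.integral_deriv_eq_sub
  have hφb : φ b = 0 := hw0
  have hφa : φ a = 0 := by simp [hφ]
  rw [hφb, hφa, inner_zero_right, inner_zero_right, sub_zero] at h0
  have h1 : ∫ t in a..b, deriv (fun t => inner ℝ (G t) (φ t)) t =
      ∫ t in a..b, (inner ℝ (G t) (w t) + inner ℝ (g t) (φ t)) := by
    refine intervalIntegral.integral_congr_ae ?_
    filter_upwards [hg.ae_hasDerivAt_integral, hw.ae_hasDerivAt_integral] with t h2 h3 ht
    have ht' := uIoc_subset_uIcc ht
    exact ((h2 ht' a left_mem_uIcc).inner ℝ (h3 ht' a left_mem_uIcc)).deriv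
  have hI1 : IntegrableOn (fun t => inner ℝ (G t) (w t)) (Ioo a b) := by
    rw [uIcc_of_le hab] at hGc
    obtain ⟨C, hC⟩ := isCompact_Icc.exists_bound_of_continuousOn hGc
    rw [intervalIntegrable_iff_integrableOn_Ioo_of_le hab] at hw
    refine Integrable.mono' (hw.norm.const_mul C) (((hGc.mono
      Ioo_subset_Icc_self).aestronglyMeasurable measurableSet_Ioo).inner hw.1) ?_
    filter_upwards [ae_restrict_mem measurableSet_Ioo] with t ht
    refine (norm_inner_le_norm _ _).trans ?_
    gcongr
    exact hC t (Ioo_subset_Icc_self ht)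
  have hI2 : IntegrableOn (fun t => inner ℝ (g t) (φ t)) (Ioo a b) := by
    rw [uIcc_of_le hab] at hφc
    obtain ⟨C, hC⟩ := isCompact_Icc.exists_bound_of_continuousOn hφc
    rw [intervalIntegrable_iff_integrableOn_Ioo_of_le hab] at hg
    refine Integrable.mono' (hg.norm.mul_const C) (hg.1.inner ((hφc.mono
      Ioo_subset_Icc_self).aestronglyMeasurable measurableSet_Ioo)) ?_
    filter_upwards [ae_restrict_mem measurableSet_Ioo] with t ht
    refine (norm_inner_le_norm _ _).trans ?_
    gcongr
    exact hC t (Ioo_subset_Icc_self ht)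
  rw [h1, intervalIntegral.integral_of_le hab, ← restrict_Ioo_eq_restrict_Ioc,
    integral_add hI1 hI2] at h0
  linarith

/-- The velocity of a collisionless minimizer is, up to a constant, the primitive of the force. -/
theorem Achieves.ae_deriv_eq (hp : ContMDiff (𝓡 n) 𝓘(ℝ, ℝ) 2 p.1) (hV : 0 ≤ Vmin)
    (hmin : ∀ s, Vmin ≤ p.1 s) (hx : Achieves ξm ξp p a b x) {ρ : ℝ} (hρ : 0 < ρ)
    (hρx : ∀ t ∈ Icc a b, ρ ≤ ‖x t‖) :
    ∃ m : Space n, ∀ᵐ t ∂volume.restrict (Ioo a b),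
      deriv x t = (∫ s in a..t, gradient (potential p) (x s)) + m := by
  have hadm := hx.1
  have hlt := hadm.lt
  have hab := hlt.le
  have hxc := hadm.isH1.continuousOn hab
  have hgc : ContinuousOn (fun t => gradient (potential p) (x t)) (uIcc a b) := by
    rw [uIcc_of_le hab]
    exact fun t ht => (continuousAt_gradient_potential hp (norm_pos_iff.1 (hρ.trans_le
      (hρx t ht)))).comp_continuousWithinAt (hxc t ht)
  have hgI := hgc.intervalIntegrable (μ := volume)
  set G : ℝ → Space n := fun t => ∫ s in a..t, gradient (potential p) (x s) with hG
  have hGc : ContinuousOn G (Icc a b) := by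
    have := hgI.absolutelyContinuousOnInterval_integral_normed.continuousOn
    rwa [uIcc_of_le hab] at this
  have hGL : MemLp G 2 (volume.restrict (Ioo a b)) := by
    obtain ⟨C, hC⟩ := isCompact_Icc.exists_bound_of_continuousOn hGc
    refine MemLp.of_bound ((hGc.mono Ioo_subset_Icc_self).aestronglyMeasurable
      measurableSet_Ioo) C ?_
    filter_upwards [ae_restrict_mem measurableSet_Ioo] with t ht
    exact hC t (Ioo_subset_Icc_self ht)
  have huL : MemLp (fun t => deriv x t - G t) 2 (volume.restrict (Ioo a b)) := hadm.isH1.2.sub hGL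
  have huI := intervalIntegrable_of_memLp_Ioo huL hab
  -- Du Bois-Reymond: subtracting the mean `m` makes `w` an allowed test velocity. Testing with `w`
  -- itself, to which constants are orthogonal, gives `∫ |w|² = 0`.
  set m : Space n := (b - a)⁻¹ • ∫ t in a..b, (deriv x t - G t) with hm
  set w : ℝ → Space n := fun t => deriv x t - G t - m with hw
  have hwL : MemLp w 2 (volume.restrict (Ioo a b)) := huL.sub (memLp_const m)
  have hwI := intervalIntegrable_of_memLp_Ioo hwL hab
  have hw0 : ∫ t in a..b, w t = 0 := by
    rw [hw, intervalIntegral.integral_sub huI intervalIntegrable_const,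
      intervalIntegral.integral_const, hm, smul_smul, mul_inv_cancel₀ (sub_pos.2 hlt).ne',
      one_smul, sub_self]
  have hvar := hx.first_variation hp hV hmin hρ hρx hwL hw0
  rw [integral_inner_primitive_eq_neg hab hgI hwI hw0] at hvar
  have hinner : ∀ {f : ℝ → Space n}, MemLp f 2 (volume.restrict (Ioo a b)) →
      Integrable (fun t => inner ℝ (f t) (w t)) (volume.restrict (Ioo a b)) := fun hf =>
    integrable_inner_of_memLp hf hwL
  have hm0 : ∫ t in Ioo a b, inner ℝ m (w t) = 0 := by
    rw [integral_inner (hwL.integrable one_le_two), restrict_Ioo_eq_restrict_Ioc,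
      ← intervalIntegral.integral_of_le hab, hw0, inner_zero_right]
  have hsq : ∫ t in Ioo a b, ‖w t‖ ^ 2 = 0 := by
    have heq : ∀ t, ‖w t‖ ^ 2 =
        inner ℝ (deriv x t) (w t) - inner ℝ (G t) (w t) - inner ℝ m (w t) := fun t => by
      rw [← inner_sub_left, ← inner_sub_left, ← real_inner_self_eq_norm_sq]
    have h12 : Integrable (fun t => inner ℝ (deriv x t) (w t) - inner ℝ (G t) (w t))
        (volume.restrict (Ioo a b)) := (hinner hadm.isH1.2).sub (hinner hGL)
    simp_rw [heq]
    rw [integral_sub h12 (hinner (memLp_const m)), integral_sub (hinner hadm.isH1.2) (hinner hGL),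
      hm0]
    linarith
  refine ⟨m, ?_⟩
  have hae := (integral_eq_zero_iff_of_nonneg (fun t => by positivity)
    ((memLp_two_iff_integrable_sq_norm hwL.1).1 hwL)).1 hsq
  filter_upwards [hae] with t ht
  have h0 : w t = 0 := by simpa using ht
  rw [← sub_eq_zero, ← sub_sub]
  exact h0

/-- The velocity agrees almost everywhere with a continuous function, and `x` is a primitive of that
function. Hence it is the derivative of `x` at every interior time, and it is itself differentiable
with derivative the force. -/
theorem Achieves.isSolution (hp : ContMDiff (𝓡 n) 𝓘(ℝ, ℝ) 2 p.1) (hV : 0 ≤ Vmin)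
    (hmin : ∀ s, Vmin ≤ p.1 s) (hx : Achieves ξm ξp p a b x) {ρ : ℝ} (hρ : 0 < ρ)
    (hρx : ∀ t ∈ Icc a b, ρ ≤ ‖x t‖) : IsSolution p a b x := by
  obtain ⟨m, hm⟩ := hx.ae_deriv_eq hp hV hmin hρ hρx
  have hadm := hx.1
  have hab := hadm.lt.le
  have hxc := hadm.isH1.continuousOn hab
  have hgc : ContinuousOn (fun t => gradient (potential p) (x t)) (Icc a b) := fun t ht =>
    (continuousAt_gradient_potential hp (norm_pos_iff.1 (hρ.trans_le
      (hρx t ht)))).comp_continuousWithinAt (hxc t ht)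
  have hgG : ∀ {f : ℝ → Space n}, ContinuousOn f (Icc a b) → ∀ t ∈ Ioo a b,
      HasDerivAt (fun s => ∫ r in a..s, f r) (f t) t := fun {f} hf t ht => by
    have hI : IntervalIntegrable f volume a t := by
      refine (hf.mono ?_).intervalIntegrable
      rw [uIcc_of_le ht.1.le]
      exact Icc_subset_Icc le_rfl ht.2.le
    refine intervalIntegral.integral_hasDerivAt_right hI ?_
      (hf.continuousAt (Icc_mem_nhds ht.1 ht.2))
    exact (hf.mono Ioo_subset_Icc_self).stronglyMeasurableAtFilter isOpen_Ioo t ht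
  set v : ℝ → Space n := fun t => (∫ s in a..t, gradient (potential p) (x s)) + m with hv
  have hvc : ContinuousOn v (Icc a b) := by
    have hI : IntervalIntegrable (fun s => gradient (potential p) (x s)) volume a b :=
      ContinuousOn.intervalIntegrable (by rwa [uIcc_of_le hab])
    have := hI.absolutelyContinuousOnInterval_integral_normed.continuousOn
    rw [uIcc_of_le hab] at this
    exact this.add continuousOn_const
  have hxd : ∀ t ∈ Ioo a b, HasDerivAt x (v t) t := fun t ht => by
    refine ((hgG hvc t ht).const_add (x a)).congr_of_eventuallyEq ?_
    filter_upwards [isOpen_Ioo.mem_nhds ht] with s hs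
    rw [hadm.isH1.integral_deriv (Ioo_subset_Icc_self hs), intervalIntegral.integral_of_le hs.1.le,
      intervalIntegral.integral_of_le hs.1.le, ← restrict_Ioo_eq_restrict_Ioc]
    congr 1
    exact integral_congr_ae (ae_restrict_of_ae_restrict_of_subset
      (Ioo_subset_Ioo le_rfl hs.2.le) hm)
  intro t ht
  refine ⟨norm_pos_iff.1 (hρ.trans_le (hρx t (Ioo_subset_Icc_self ht))),
    (hxd t ht).differentiableAt, ?_⟩
  refine ((hgG hgc t ht).add_const m).congr_of_eventuallyEq ?_
  filter_upwards [isOpen_Ioo.mem_nhds ht] with s hs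
  exact (hxd s hs).deriv

end AnisotropicKepler

/-! ### The dichotomy -/

theorem mainTheorem4 {n : ℕ} (hn : 1 ≤ n) (ξm ξp : AnisotropicKepler.UnitSphere n) (hξ : ξp ≠ ξm)
    (Vmin : ℝ) (hVmin : 0 < Vmin) (V : (AnisotropicKepler.UnitSphere n → ℝ) × ℝ)
    (hV : V ∈ AnisotropicKepler.classP ξm ξp Vmin) :
    (∃ (a b : ℝ) (x : ℝ → AnisotropicKepler.Space n),
      AnisotropicKepler.Achieves ξm ξp V a b x) ∧
    Xor
      (AnisotropicKepler.level ξm ξp V = ENNReal.ofReal (4 * √(2 * Vmin) / (2 - V.2)) ∧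
        ∃ (a b : ℝ) (x : ℝ → AnisotropicKepler.Space n),
          AnisotropicKepler.Achieves ξm ξp V a b x ∧
            AnisotropicKepler.IsDoubleHomothetic ξm ξp V a b x)
      (AnisotropicKepler.level ξm ξp V < ENNReal.ofReal (4 * √(2 * Vmin) / (2 - V.2)) ∧
        ∃ ρ : ℝ, 0 < ρ ∧ ∀ (a b : ℝ) (x : ℝ → AnisotropicKepler.Space n),
          AnisotropicKepler.Achieves ξm ξp V a b x →
            AnisotropicKepler.IsSolution V a b x ∧ ∀ t ∈ Set.Icc a b, ρ ≤ ‖x t‖) := by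
  open AnisotropicKepler in
  obtain ⟨hS, hα0, hα2⟩ := hV
  have hadm := isAdmissible_collisionPath (ξm := ξm) (ξp := ξp) hVmin hα0 hα2
  have haction := action_collisionPath (p := V) hVmin hS.eq_left hS.eq_right hα0 hα2
  have hle := (level_le_action (p := V) hadm).trans_eq haction
  rcases hle.eq_or_lt with heq | hlt
  · have hach : Achieves ξm ξp V _ _ (collisionPath ξm ξp Vmin V.2) :=
      ⟨hadm, haction.trans heq.symm⟩
    exact ⟨⟨_, _, _, hach⟩, Or.inl ⟨⟨heq, _, _, _, hach, isDoubleHomothetic_collisionPath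
      hS.contMDiff hVmin hS.min_le hS.eq_left hS.eq_right hα0 hα2⟩, fun h => h.1.ne heq⟩⟩
  · refine ⟨exists_achieves_of_level_lt hS.contMDiff hξ hVmin hS.min_le hα0 hα2 hlt,
      Or.inr ⟨⟨hlt, ?_⟩, fun h => hlt.ne h.1⟩⟩
    -- The annulus is taken for the action bound `level ξm ξp V` itself, so one `ρ` serves all
    -- minimizers.
    obtain ⟨ρ, R, hρ, -, hann⟩ := exists_annulus (p := V) hVmin hS.min_le hα0 hα2 hlt
    refine ⟨ρ, hρ, fun a b x hx => ?_⟩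
    have hρx : ∀ t ∈ Icc a b, ρ ≤ ‖x t‖ := fun t ht => (hann _ _ _ _ _ hx.1 hx.2.le t ht).1
    exact ⟨hx.isSolution hS.contMDiff hVmin.le hS.min_le hρ hρx, hρx⟩
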